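/- Let $\mathbb R^3_1$ be $\mathbb R^3$ with coordinates $(t,x,y)$ and the inner product $\langle\,,\rangle=-dt^2+dx^2+dy^2$. A real analytic curve $\gamma:I\to\mathbb R^3_1$ on a nonempty open interval $I$ is called a non-degenerate null curve if, for all $s\in I$, $\gamma'(s)\neq 0$, $\langle\gamma'(s),\gamma'(s)\rangle=0$, and $\gamma''(s)$ is not a multiple of $\gamma'(s)$. Such a curve extends to a holomorphic map (again denoted $\gamma$) into $\mathbb C^3$ on an open neighbourhood of $I$ in $\mathbb C$; near $I$ the extension is unique. Set $$\hat\phi_\gamma(u,v)=\begin{cases}\frac12\bigl(\gamma(u+i\sqrt v)+\gamma(u-i\sqrt v)\bigr)&(v\ge 0),\\[2pt] \frac12\bigl(\gamma(u+\sqrt{|v|})+\gamma(u-\sqrt{|v|})\bigr)&(v<0).\end{cases}$$ For a $C^\infty$ function $f$ on a domain $\Omega\subset\mathbb R^2$, consider the zero mean curvature equation $$(1-f_y^2)f_{xx}+2f_xf_yf_{xy}+(1-f_x^2)f_{yy}=0,\qquad(\ast)$$ and put $B=1-f_x^2-f_y^2$. If $f$ satisfies $(\ast)$, a point $p\in\Omega$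 is a non-degenerate point of type change with respect to $f$ if $B(p)=0$ and $\nabla B(p)\ne 0$. An immersion $\phi(u,v)$ into $\mathbb R^3_1$ is a zero mean curvature immersion if $EN-2FM+GL=0$, where $E,F,G$ are the coefficients of its first fundamental form and $L,M,N$ those of its second fundamental form with respect to the normal field $\nu$ given by $\langle X,\nu\rangle=\det(X,\phi_u,\phi_v)$ (where $EG-F^2\neq0$, this says that the mean curvature vanishes; for a graph $t=f(x,y)$ it is $(\ast)$). **Theorem.** (1) Let $\gamma:I\to\mathbb R^3_1$ be a real analytic non-degenerate null curve. Then there is an open neighbourhood $W$ of $I\times\{0\}$ in $\mathbb R^2$ on which $\hat\phi_\gamma$ is well defined, takes values in $\mathbb R^3_1$, and is a real analytic zero mean curvature immersion. Moreover, for each $u\in I$, $\hat\phi_\gamma(u,0)=\gamma(u)$, and this is a non-degenerate point of type change of $\hat\phi_\gamma$: there are an open neighbourhood $V\subset W$ of $(u,0)$ and a real analytic solution $f$ of $(\ast)$ on a domain $\Omega\subset\mathbb R^2$ such that $\hat\phi_\gamma(V)$ is the graph $\{(f(x,y),x,y):(x,y)\in\Omega\}$ and the projection of $\gamma(u)$ to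 the $xy$-plane is a non-degenerate point of type change with respect to $f$. (2) Conversely, let $f$ be a $C^\infty$ solution of $(\ast)$ on a domain $\Omega\subset\mathbb R^2$ and let $p=(x_0,y_0)\in\Omega$ be a non-degenerate point of type change with respect to $f$. Then there are a real analytic non-degenerate null curve $\gamma:I\to\mathbb R^3_1$ and $u_0\in I$ with $\gamma(u_0)=(f(x_0,y_0),x_0,y_0)$, an open neighbourhood $V$ of $(u_0,0)$ on which $\hat\phi_\gamma$ is defined and real valued, and an open neighbourhood $\Omega'\subset\Omega$ of $p$, such that $\hat\phi_\gamma(V)$ is the graph $\{(f(x,y),x,y):(x,y)\in\Omega'\}$ of $f$ over $\Omega'$. -/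

import Mathlib

open scoped ContDiff

noncomputable section

namespace TypeChange

/-- Lorentz-Minkowski `3`-space `ℝ³₁`, with coordinates `(t, x, y)` indexed by `0, 1, 2`. -/
abbrev Mink := Fin 3 → ℝ

/-- The Lorentzian inner product of signature `(-,+,+)`. -/
def lorentz (v w : Mink) : ℝ := -(v 0 * w 0) + v 1 * w 1 + v 2 * w 2

/-- A light-like vector. -/
def IsLightlike (v : Mink) : Prop := v ≠ 0 ∧ lorentz v v = 0

/-- The Lorentzian cross product, characterised by `⟨X, a × b⟩ = det (X, a, b)`. -/
def lorentzCross (a b : Mink) : Mink :=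
  ![-(a 1 * b 2 - a 2 * b 1), a 2 * b 0 - a 0 * b 2, a 0 * b 1 - a 1 * b 0]

/-! ### Null curves and their holomorphic extensions -/

/-- `γ`, restricted to the nonempty open interval `I` (bounded or not), is a real analytic
non-degenerate null curve: the velocity is light-like (in particular non-zero) and the
acceleration is nowhere proportional to the velocity. -/
structure IsNondegenerateNullCurve (I : Set ℝ) (γ : ℝ → Mink) : Prop where
  isOpen : IsOpen I
  ordConnected : I.OrdConnected
  nonempty : I.Nonempty
  analytic : AnalyticOnNhd ℝ γ I
  null : ∀ t ∈ I, IsLightlike (deriv γ t)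
  nondegenerate : ∀ t ∈ I, ¬ ∃ k : ℝ, deriv (deriv γ) t = k • deriv γ t

/-- `Γ` is a holomorphic extension of the curve `γ : I → ℝ³` to the open set `U ⊆ ℂ`,
`I ⊆ U`, with values in `ℂ³`. -/
structure IsHolomorphicExtension (I : Set ℝ) (γ : ℝ → Mink)
    (U : Set ℂ) (Γ : ℂ → Fin 3 → ℂ) : Prop where
  isOpen : IsOpen U
  subset : ∀ t ∈ I, (t : ℂ) ∈ U
  holomorphic : DifferentiableOn ℂ Γ U
  agree : ∀ t ∈ I, ∀ j, Γ (t : ℂ) j = (γ t j : ℂ)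

/-- The formula for `φ̂_γ(u, v)`, as a vector of `ℂ³`; `Γ` is the holomorphic extension of `γ`. -/
def phiHatC (Γ : ℂ → Fin 3 → ℂ) (q : ℝ × ℝ) : Fin 3 → ℂ :=
  if 0 ≤ q.2 then
    (2⁻¹ : ℂ) • (Γ (q.1 + Complex.I * (√q.2 : ℝ)) + Γ (q.1 - Complex.I * (√q.2 : ℝ)))
  else
    (2⁻¹ : ℂ) • (Γ ((q.1 + √|q.2| : ℝ) : ℂ) + Γ ((q.1 - √|q.2| : ℝ) : ℂ))

/-- `φ̂_γ` as a map to `ℝ³₁`. -/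
def phiHat (Γ : ℂ → Fin 3 → ℂ) (q : ℝ × ℝ) : Mink := fun j => (phiHatC Γ q j).re

/-- The points `(u, v)` at which the formula for `φ̂_γ` is meaningful for the curve
`γ` on `I` and its extension to `U`. -/
def phiHatDomain (I : Set ℝ) (U : Set ℂ) : Set (ℝ × ℝ) :=
  {q | (0 ≤ q.2 → (q.1 + Complex.I * (√q.2 : ℝ) : ℂ) ∈ U ∧
          (q.1 - Complex.I * (√q.2 : ℝ) : ℂ) ∈ U) ∧
       (q.2 < 0 → q.1 + √|q.2| ∈ I ∧ q.1 - √|q.2| ∈ I)}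

/-! ### Zero mean curvature -/

/-- Partial derivative with respect to the first variable. -/
def d₁ {E : Type*} [NormedAddCommGroup E] [NormedSpace ℝ E] (g : ℝ × ℝ → E) (q : ℝ × ℝ) : E :=
  fderiv ℝ g q (1, 0)

/-- Partial derivative with respect to the second variable. -/
def d₂ {E : Type*} [NormedAddCommGroup E] [NormedSpace ℝ E] (g : ℝ × ℝ → E) (q : ℝ × ℝ) : E :=
  fderiv ℝ g q (0, 1)

/-- The normal direction `φ_u × φ_v` (not normalised, so that it also makes sense at
light-like points). -/
def normal (φ : ℝ × ℝ → Mink) (q : ℝ × ℝ) : Mink := lorentzCross (d₁ φ q) (d₂ φ q)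

/-- `E N - 2 F M + G L`, where `E, F, G` is the first fundamental form and `L, M, N` is the second
fundamental form with respect to the normal `ν = φ_u × φ_v`. Where `EG - F² ≠ 0`, the mean
curvature is, up to sign, this divided by `2 (EG - F²) |⟨ν,ν⟩|^(1/2)`, and
`|⟨ν,ν⟩| = |EG - F²|`. For a graph `(x, y) ↦ (f(x,y), x, y)` it is
`(1 - f_y²) f_xx + 2 f_x f_y f_xy + (1 - f_x²) f_yy`. -/
def meanCurvatureNumerator (φ : ℝ × ℝ → Mink) (q : ℝ × ℝ) : ℝ :=
  lorentz (d₁ φ q) (d₁ φ q) * lorentz (d₂ (d₂ φ) q) (normal φ q)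
    - 2 * lorentz (d₁ φ q) (d₂ φ q) * lorentz (d₂ (d₁ φ) q) (normal φ q)
    + lorentz (d₂ φ q) (d₂ φ q) * lorentz (d₁ (d₁ φ) q) (normal φ q)

/-- `φ` is a real analytic zero mean curvature immersion of the open set `W` into `ℝ³₁`
(of possibly varying causal type). -/
structure IsAnalyticZMCImmersion (W : Set (ℝ × ℝ)) (φ : ℝ × ℝ → Mink) : Prop where
  isOpen : IsOpen W
  analytic : AnalyticOnNhd ℝ φ W
  immersion : ∀ q ∈ W, Function.Injective (fderiv ℝ φ q)
  zero_mean_curvature : ∀ q ∈ W, meanCurvatureNumerator φ q = 0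

/-- `f` is a `C^∞` solution of the zero mean curvature equation on the domain `Ω`. -/
structure IsZMCSolution (Ω : Set (ℝ × ℝ)) (f : ℝ × ℝ → ℝ) : Prop where
  isOpen : IsOpen Ω
  isConnected : IsConnected Ω
  smooth : ContDiffOn ℝ ∞ f Ω
  equation : ∀ q ∈ Ω,
    (1 - d₂ f q ^ 2) * d₁ (d₁ f) q + 2 * d₁ f q * d₂ f q * d₂ (d₁ f) q
      + (1 - d₁ f q ^ 2) * d₂ (d₂ f) q = 0

/-- The function `B = 1 - f_x² - f_y²`. -/
def typeFun (f : ℝ × ℝ → ℝ) (q : ℝ × ℝ) : ℝ := 1 - d₁ f q ^ 2 - d₂ f q ^ 2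

/-- `p` is a non-degenerate point of type change with respect to `f`: `B(p) = 0`, `∇B(p) ≠ 0`. -/
def IsNondegenerateTypeChange (f : ℝ × ℝ → ℝ) (p : ℝ × ℝ) : Prop :=
  typeFun f p = 0 ∧ (d₁ (typeFun f) p, d₂ (typeFun f) p) ≠ ((0, 0) : ℝ × ℝ)

/-- The graph `t = f(x, y)` over `Ω`, as a subset of `ℝ³₁`. -/
def graphOver (f : ℝ × ℝ → ℝ) (Ω : Set (ℝ × ℝ)) : Set Mink :=
  (fun p : ℝ × ℝ => ![f p, p.1, p.2]) '' Ω

/-- The point `φ q₀` of the surface `φ : W → ℝ³₁` is a non-degenerate point of type change: near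
`q₀` the surface is the graph of a real analytic solution `f` of the zero mean curvature
equation, and the projection of `φ q₀` to the `xy`-plane is a non-degenerate point of type
change with respect to `f`. -/
def IsNondegenerateTypeChangeOfSurface (W : Set (ℝ × ℝ)) (φ : ℝ × ℝ → Mink) (q₀ : ℝ × ℝ) : Prop :=
  ∃ V ⊆ W, IsOpen V ∧ q₀ ∈ V ∧ ∃ (Ω : Set (ℝ × ℝ)) (f : ℝ × ℝ → ℝ),
    IsZMCSolution Ω f ∧ AnalyticOnNhd ℝ f Ω ∧ φ '' V = graphOver f Ω ∧
    IsNondegenerateTypeChange f (φ q₀ 1, φ q₀ 2)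

end TypeChange

end

open scoped ContDiff

namespace TypeChange

open Filter Topology Complex

/-! Direct part. With `v = -τ²` the map is `½(γ(u+τ) + γ(u-τ))`, a half sum of two null curves. Such
a sum solves the wave equation in `(u, τ)`, has `φ_u ⟂ φ_τ`, and satisfies `⟨φ_u,φ_u⟩ = -⟨φ_τ,φ_τ⟩`.
It is even in `τ`, hence an analytic function of `v` across `v = 0` (`exists_analyticAt_even_part`).
The three relations, rewritten in `v` as `EvenNullData`, pass from `v < 0` to both sides by the
identity theorem (`eventually_evenNullData`), and zero mean curvature is a formal consequence. On `v
= 0` one has `φ_u = γ'` and `φ_v = -½γ''`. Since `γ''` is orthogonal to the null vector `γ'` and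
independent of it, the surface projects diffeomorphically to the `xy`-plane and `G = ⟨φ_v,φ_v⟩ ≠ 0`.
With `J` the Jacobian of the projection, `J²B = 4vG²`, so `B` vanishes exactly to first order.

Converse. At a non-degenerate point of type change the Hessian is invertible
(`injective_fderiv_grad`), so the gradient can serve as coordinates. Write it in polar form with
angle `θ` and radius `ρ(τ)`, where `ρ = 1/cosh` on the side `|∇f| < 1` and `ρ = 1/cos` on the side
`|∇f| > 1`. The equation then becomes a first order system, and the three coordinates of the graph
are harmonic in `(θ, τ)` on the first side and solve the wave equation on the second
(`surf_equation`). Since `ρ'(0) = 0`, their `τ`-derivatives vanish on `τ = 0`, the curve `γ` where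
`|∇f| = 1`. A harmonic function with zero normal derivative is the real part of a holomorphic
function real on the axis (`exists_holomorphic_of_harmonic`). This extends `γ` holomorphically, and
so proves it analytic although `f` is only smooth. On the other side `dAlembert` gives the half sum.
The two halves, with `v = τ²` and `v = -τ²`, make up `φ̂_γ` (`eventually_phiHat_mem_graph`). -/

theorem _root_.HasSum.of_eq {ι E : Type*} [AddCommMonoid E] [TopologicalSpace E] {f g : ι → E} {a : E}
    (hf : HasSum f a) (h : ∀ n, f n = g n) : HasSum g a :=
  (funext h : f = g) ▸ hf

/-! ### Even parts of analytic functions, by functional calculus -/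

/-- This lets one scalar series be summed over the same radius in `ℂ` and in the operators on `ℝ²`.
-/
theorem radius_ofScalars_eq (A : Type*) [NormedRing A] [NormedAlgebra ℝ A] [NormOneClass A]
    (a : ℕ → ℝ) :
    (FormalMultilinearSeries.ofScalars A a).radius =
      (FormalMultilinearSeries.ofScalars ℝ a).radius := by
  simp only [FormalMultilinearSeries.radius, FormalMultilinearSeries.ofScalars_norm]

/-- An operator on `ℝ²` with eigenvalues `h ± i √v`. -/
noncomputable def evenOp (ε : ℝ) (q : ℝ × ℝ) : ℝ × ℝ →L[ℝ] ℝ × ℝ :=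
  q.1 • ContinuousLinearMap.id ℝ (ℝ × ℝ) +
    q.2 • ((-ε⁻¹) • (ContinuousLinearMap.inl ℝ ℝ ℝ).comp (ContinuousLinearMap.snd ℝ ℝ ℝ)) +
    ε • (ContinuousLinearMap.inr ℝ ℝ ℝ).comp (ContinuousLinearMap.fst ℝ ℝ ℝ)

theorem evenOp_apply (ε : ℝ) (q w : ℝ × ℝ) :
    evenOp ε q w = (q.1 * w.1 - q.2 * ε⁻¹ * w.2, q.1 * w.2 + ε * w.1) := by
  ext <;> simp [evenOp]
  ring

/-- `(0, ε)` is the half sum of the vectors `(±is, ε)`, which the operator multiplies by `h ± is`.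
The induction never divides by `s`, so `v = 0` is included, and `s` may be any complex square root,
which covers both signs of `v`. -/
theorem evenOp_pow_apply {ε : ℝ} (hε : ε ≠ 0) (q : ℝ × ℝ) (s : ℂ) (hs : s ^ 2 = q.2) (n : ℕ) :
    (((evenOp ε q ^ n) (0, ε)).1 : ℂ) =
        2⁻¹ * (I * s) * ((q.1 + I * s) ^ n - (q.1 - I * s) ^ n) ∧
      (((evenOp ε q ^ n) (0, ε)).2 : ℂ) =
        2⁻¹ * ε * ((q.1 + I * s) ^ n + (q.1 - I * s) ^ n) := by
  induction n with
  | zero => simp; ring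
  | succ n ih =>
    have hε' : (ε : ℂ) ≠ 0 := by exact_mod_cast hε
    rw [pow_succ', mul_apply_eq_comp, evenOp_apply]
    simp only [ofReal_add, ofReal_sub, ofReal_mul, ofReal_inv]
    rw [ih.1, ih.2, ← hs]
    constructor
    · field_simp
      ring_nf
      simp only [I_sq]
      ring
    · ring

/-- The Taylor series of `g` is summed at `evenOp`, which depends affinely on `(u, v)`; the result
is analytic with no square root in sight. Its action on `(0, ε)` is compared term by term with the
half sum of the same series in `ℂ`. -/
theorem exists_analyticAt_even_part {g : ℝ → ℝ} {u₀ : ℝ} (hg : AnalyticAt ℝ g u₀) :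
    ∃ (G : ℝ × ℝ → ℝ) (C : ℂ → ℂ), AnalyticAt ℝ G (u₀, 0) ∧ AnalyticAt ℂ C u₀ ∧
      (∀ᶠ t : ℝ in 𝓝 u₀, C t = g t) ∧
      ∀ᶠ q : ℝ × ℝ in 𝓝 (u₀, 0), ∀ s : ℂ, s ^ 2 = q.2 →
        (G q : ℂ) = 2⁻¹ * (C (q.1 + I * s) + C (q.1 - I * s)) := by
  obtain ⟨p, hp⟩ := hg
  set a : ℕ → ℝ := p.coeff with ha
  set R := (FormalMultilinearSeries.ofScalars ℝ a).radius with hR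
  have hpa : p = FormalMultilinearSeries.ofScalars ℝ a := by
    rw [FormalMultilinearSeries.ext_iff]
    intro n
    rw [← FormalMultilinearSeries.mkPiRing_coeff_eq p n]
    ext
    simp [FormalMultilinearSeries.ofScalars, ha]
  have hR0 : 0 < R := by rw [hR, ← hpa]; exact hp.radius_pos
  obtain ⟨r, hr0, hrR⟩ : ∃ r : ℝ, 0 < r ∧ ENNReal.ofReal r < R := by
    obtain ⟨r, hr0, hr⟩ := ENNReal.lt_iff_exists_nnreal_btwn.1 hR0
    exact ⟨r, by simpa using hr0, by simpa using hr⟩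
  have hsum : ∀ (A : Type) [NormedRing A] [NormedAlgebra ℝ A] [NormOneClass A] [CompleteSpace A]
      (x : A), ‖x‖ < r → HasSum (fun n => a n • x ^ n) (FormalMultilinearSeries.ofScalarsSum a x) := by
    intro A _ _ _ _ x hx
    have h := (FormalMultilinearSeries.ofScalars A a).hasSum (x := x) (by
      rw [radius_ofScalars_eq, ← hR]
      simp only [Metric.mem_eball, edist_zero_right]
      refine lt_trans ?_ hrR
      rw [← ofReal_norm]
      exact (ENNReal.ofReal_lt_ofReal_iff hr0).2 hx)
    simp only [FormalMultilinearSeries.ofScalars_apply_eq] at h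
    exact h
  have han : ∀ (A : Type) [NormedRing A] [NormedAlgebra ℝ A] [NormOneClass A] [CompleteSpace A]
      (x : A), ‖x‖ < r → AnalyticAt ℝ (FormalMultilinearSeries.ofScalarsSum a : A → A) x := by
    intro A _ _ _ _ x hx
    have h := (FormalMultilinearSeries.ofScalars A a).hasFPowerSeriesOnBall
      (by rw [radius_ofScalars_eq]; exact hR0)
    refine h.analyticAt_of_mem ?_
    rw [radius_ofScalars_eq, ← hR]
    simp only [Metric.mem_eball, edist_zero_right]
    refine lt_trans ?_ hrR
    rw [← ofReal_norm]
    exact (ENNReal.ofReal_lt_ofReal_iff hr0).2 hx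
  set F : ℂ → ℂ := FormalMultilinearSeries.ofScalarsSum a with hF
  have hFan : AnalyticAt ℂ F 0 := by
    have h : HasFPowerSeriesAt F (FormalMultilinearSeries.ofScalars ℂ (fun n => (a n : ℂ))) 0 := by
      rw [hasFPowerSeriesAt_iff]
      filter_upwards [Metric.ball_mem_nhds (0 : ℂ) hr0] with z hz
      simpa [mul_comm] using hsum ℂ z (by simpa using hz)
    exact h.analyticAt
  set S : (ℝ × ℝ →L[ℝ] ℝ × ℝ) → (ℝ × ℝ →L[ℝ] ℝ × ℝ) := FormalMultilinearSeries.ofScalarsSum a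
    with hS
  set N : ℝ × ℝ →L[ℝ] ℝ × ℝ :=
    (ContinuousLinearMap.inr ℝ ℝ ℝ).comp (ContinuousLinearMap.fst ℝ ℝ ℝ) with hN
  -- At the centre the operator is `ε N`, nilpotent but not zero; a small `ε` brings its norm inside
  -- the ball of convergence.
  obtain ⟨ε, hε0, hε⟩ : ∃ ε : ℝ, 0 < ε ∧ ε * ‖N‖ < r := by
    refine ⟨r / (‖N‖ + 1), by positivity, ?_⟩
    rw [div_mul_eq_mul_div, div_lt_iff₀ (by positivity)]
    nlinarith [norm_nonneg N]
  set sh : ℝ × ℝ → ℝ × ℝ := fun q => (q.1 - u₀, q.2) with hsh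
  have hsh_an : ∀ q, AnalyticAt ℝ sh q := fun q =>
    (analyticAt_fst.sub analyticAt_const).prod analyticAt_snd
  have hM_an : ∀ q, AnalyticAt ℝ (evenOp ε) q := by
    intro q
    exact ((analyticAt_fst.smul analyticAt_const).add (analyticAt_snd.smul analyticAt_const)).add
      analyticAt_const
  have hsh0 : sh (u₀, 0) = 0 := by simp [hsh]
  have hM0 : ‖evenOp ε (sh (u₀, 0))‖ < r := by
    rw [hsh0]
    simpa [evenOp, norm_smul, abs_of_pos hε0] using hε
  have hMsh : AnalyticAt ℝ (fun q => evenOp ε (sh q)) (u₀, 0) :=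
    (hM_an _).comp (hsh_an _)
  refine ⟨fun q => ε⁻¹ * (S (evenOp ε (sh q)) (0, ε)).2, fun z => F (z - u₀), ?_, ?_, ?_, ?_⟩
  · refine analyticAt_const.mul ?_
    have h1 : AnalyticAt ℝ (fun q => S (evenOp ε (sh q))) (u₀, 0) :=
      AnalyticAt.fun_comp (f := fun q => evenOp ε (sh q)) (han _ _ hM0) hMsh
    exact ((ContinuousLinearMap.snd ℝ ℝ ℝ).comp
      (ContinuousLinearMap.apply ℝ (ℝ × ℝ) ((0 : ℝ), ε))).analyticAt _ |>.fun_comp h1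
  · refine AnalyticAt.fun_comp (g := F) ?_ (analyticAt_id.sub analyticAt_const)
    simpa using hFan
  · rw [hasFPowerSeriesAt_iff'] at hp
    have h2 : ∀ᶠ t : ℝ in 𝓝 u₀, ‖t - u₀‖ < r := by
      have : ContinuousAt (fun t : ℝ => ‖t - u₀‖) u₀ := by fun_prop
      exact this.eventually_lt continuousAt_const (by simpa using hr0)
    filter_upwards [hp, h2] with t ht ht2
    have h3 := hsum ℂ ((t : ℂ) - u₀) (by rw [← ofReal_sub, norm_real]; exact ht2)
    have h4 := ht.map (ofRealCLM : ℝ →+ ℂ) ofRealCLM.continuous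
    refine h3.unique (h4.of_eq fun n => ?_)
    simp [ha, mul_comm]
  · have hc1 : ∀ᶠ q in 𝓝 ((u₀, 0) : ℝ × ℝ), ‖evenOp ε (sh q)‖ < r :=
      hMsh.continuousAt.norm.eventually_lt continuousAt_const hM0
    have hc2 : ∀ᶠ q in 𝓝 ((u₀, 0) : ℝ × ℝ), |q.1 - u₀| + √|q.2| < r := by
      have : ContinuousAt (fun q : ℝ × ℝ => |q.1 - u₀| + √|q.2|) (u₀, 0) := by fun_prop
      exact this.eventually_lt continuousAt_const (by simpa using hr0)
    filter_upwards [hc1, hc2] with q h1 h2 s hs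
    have hsn : ‖s‖ = √|q.2| := by
      rw [eq_comm, Real.sqrt_eq_iff_eq_sq (abs_nonneg _) (norm_nonneg _), ← norm_pow, hs,
        norm_real, Real.norm_eq_abs]
    have hl : ‖((sh q).1 : ℂ) + I * s‖ < r := by
      refine lt_of_le_of_lt (norm_add_le _ _) ?_
      simpa [hsn, hsh, norm_real, ← ofReal_sub, -ofReal_sub] using h2
    have hm : ‖((sh q).1 : ℂ) - I * s‖ < r := by
      refine lt_of_le_of_lt (norm_sub_le _ _) ?_
      simpa [hsn, hsh, norm_real, ← ofReal_sub, -ofReal_sub] using h2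
    have k1 := hsum _ _ h1
    have k2 := ((k1.map ((ContinuousLinearMap.snd ℝ ℝ ℝ).comp
      (ContinuousLinearMap.apply ℝ (ℝ × ℝ) ((0 : ℝ), ε)) :
        (ℝ × ℝ →L[ℝ] ℝ × ℝ) →+ ℝ) (ContinuousLinearMap.continuous _)).mul_left ε⁻¹).map
        (ofRealCLM : ℝ →+ ℂ) ofRealCLM.continuous
    have k3 := ((hsum ℂ _ hl).add (hsum ℂ _ hm)).mul_left (2⁻¹ : ℂ)
    have hε' : (ε : ℂ) ≠ 0 := by exact_mod_cast hε0.ne'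
    have key : ((ε⁻¹ * (S (evenOp ε (sh q)) (0, ε)).2 : ℝ) : ℂ) =
        2⁻¹ * (F ((sh q).1 + I * s) + F ((sh q).1 - I * s)) := by
      refine HasSum.unique (k2.of_eq fun n => ?_) k3
      have := (evenOp_pow_apply hε0.ne' (sh q) s (by simpa [hsh] using hs) n).2
      simp only [Function.comp_apply, AddMonoidHom.coe_coe, ofRealCLM_apply,
        ContinuousLinearMap.comp_apply, ContinuousLinearMap.apply_apply,
        smul_apply, ContinuousLinearMap.coe_snd', Prod.smul_snd, smul_eq_mul,
        ofReal_mul, this, real_smul, ofReal_inv]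
      field_simp
    rw [key]
    simp only [hsh, ofReal_sub]
    congr 3 <;> ring

/-! ### Holomorphic extensions of the curve and analyticity of `φ̂_γ` -/

theorem tendsto_ofReal_punctured (u : ℝ) :
    Tendsto (fun t : ℝ => (t : ℂ)) (𝓝[≠] u) (𝓝[≠] (u : ℂ)) :=
  continuous_ofReal.continuousAt.continuousWithinAt.tendsto_nhdsWithin fun t ht => by
    simpa using ht

/-- Identity theorem: real points accumulate at `u`. It makes every extension of the curve agree
with the one produced by the Taylor series. -/
theorem eventuallyEq_of_eventually_ofReal {F G : ℂ → ℂ} {u : ℝ} (hF : AnalyticAt ℂ F u)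
    (hG : AnalyticAt ℂ G u) (h : ∀ᶠ t : ℝ in 𝓝 u, F t = G t) : F =ᶠ[𝓝 (u : ℂ)] G := by
  refine (hF.frequently_eq_iff_eventually_eq hG).1 ?_
  refine (tendsto_ofReal_punctured u).frequently ?_
  exact (h.filter_mono nhdsWithin_le_nhds).frequently

theorem IsHolomorphicExtension.analyticAt {I : Set ℝ} {γ : ℝ → Mink} {U : Set ℂ}
    {Γ : ℂ → Fin 3 → ℂ} (h : IsHolomorphicExtension I γ U Γ) {u : ℝ} (hu : u ∈ I) (j : Fin 3) :
    AnalyticAt ℂ (fun z => Γ z j) u := by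
  have h1 : DifferentiableOn ℂ (fun z => Γ z j) U := differentiableOn_pi.1 h.holomorphic j
  exact h1.analyticAt (h.isOpen.mem_nhds (h.subset u hu))

theorem tendsto_phiHat_args (u : ℝ) :
    Tendsto (fun q : ℝ × ℝ => (q.1 + I * (√q.2 : ℝ) : ℂ)) (𝓝 (u, 0)) (𝓝 (u : ℂ)) ∧
    Tendsto (fun q : ℝ × ℝ => (q.1 - I * (√q.2 : ℝ) : ℂ)) (𝓝 (u, 0)) (𝓝 (u : ℂ)) ∧
    Tendsto (fun q : ℝ × ℝ => q.1 + √|q.2|) (𝓝 (u, 0)) (𝓝 u) ∧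
    Tendsto (fun q : ℝ × ℝ => q.1 - √|q.2|) (𝓝 (u, 0)) (𝓝 u) := by
  refine ⟨?_, ?_, ?_, ?_⟩
  · have : ContinuousAt (fun q : ℝ × ℝ => (q.1 + I * (√q.2 : ℝ) : ℂ)) (u, 0) := by fun_prop
    simpa [ContinuousAt] using this
  · have : ContinuousAt (fun q : ℝ × ℝ => (q.1 - I * (√q.2 : ℝ) : ℂ)) (u, 0) := by fun_prop
    simpa [ContinuousAt] using this
  · have : ContinuousAt (fun q : ℝ × ℝ => q.1 + √|q.2|) (u, 0) := by fun_prop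
    simpa [ContinuousAt] using this
  · have : ContinuousAt (fun q : ℝ × ℝ => q.1 - √|q.2|) (u, 0) := by fun_prop
    simpa [ContinuousAt] using this

theorem IsHolomorphicExtension.eventually_mem_phiHatDomain {I : Set ℝ} {γ : ℝ → Mink} {U : Set ℂ}
    {Γ : ℂ → Fin 3 → ℂ} (h : IsHolomorphicExtension I γ U Γ) (hI : IsOpen I) {u : ℝ}
    (hu : u ∈ I) : ∀ᶠ q in 𝓝 ((u, 0) : ℝ × ℝ), q ∈ phiHatDomain I U := by
  obtain ⟨h1, h2, h3, h4⟩ := tendsto_phiHat_args u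
  have hU := h.isOpen.mem_nhds (h.subset u hu)
  have hI' := hI.mem_nhds hu
  filter_upwards [h1 hU, h2 hU, h3 hI', h4 hI'] with q a b c d
  exact ⟨fun _ => ⟨a, b⟩, fun _ => ⟨c, d⟩⟩

/-- Both branches of the formula are one expression in a square root `s` of `v`: for `v < 0` take `s
= -i√|v|`, so that `is = √|v|`. -/
theorem phiHatC_apply (Γ : ℂ → Fin 3 → ℂ) (q : ℝ × ℝ) (j : Fin 3) :
    ∃ s : ℂ, s ^ 2 = q.2 ∧
      phiHatC Γ q j = 2⁻¹ * (Γ (q.1 + I * s) j + Γ (q.1 - I * s) j) ∧ ‖s‖ = √|q.2| := by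
  by_cases hq : 0 ≤ q.2
  · refine ⟨(√q.2 : ℝ), ?_, ?_, ?_⟩
    · rw [← ofReal_pow, Real.sq_sqrt hq]
    · simp [phiHatC, hq]
    · rw [norm_real, Real.norm_of_nonneg (Real.sqrt_nonneg _), abs_of_nonneg hq]
  · refine ⟨-I * (√|q.2| : ℝ), ?_, ?_, ?_⟩
    · rw [mul_pow, ← ofReal_pow, Real.sq_sqrt (abs_nonneg _), abs_of_neg (not_le.1 hq)]
      simp
    · simp [phiHatC, hq, ← mul_assoc]
    · rw [norm_mul, norm_real, Real.norm_of_nonneg (Real.sqrt_nonneg _)]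
      simp

theorem exists_analyticAt_phiHatC {I : Set ℝ} {γ : ℝ → Mink} {U : Set ℂ}
    {Γ : ℂ → Fin 3 → ℂ} (h : IsHolomorphicExtension I γ U Γ) (hI : IsOpen I) {u : ℝ}
    (hu : u ∈ I) (hγ : AnalyticAt ℝ γ u) (j : Fin 3) :
    ∃ G : ℝ × ℝ → ℝ, AnalyticAt ℝ G (u, 0) ∧
      ∀ᶠ q in 𝓝 ((u, 0) : ℝ × ℝ), phiHatC Γ q j = G q := by
  obtain ⟨G, C, hG, hC, hCg, hGC⟩ := exists_analyticAt_even_part (analyticAt_pi_iff.1 hγ j)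
  have hE : C =ᶠ[𝓝 (u : ℂ)] fun z => Γ z j := by
    refine eventuallyEq_of_eventually_ofReal hC (h.analyticAt hu j) ?_
    filter_upwards [hCg, hI.mem_nhds hu] with t ht htI
    rw [ht, h.agree t htI j]
  obtain ⟨δ, hδ, hδC⟩ := Metric.eventually_nhds_iff.1 hE
  refine ⟨G, hG, ?_⟩
  have hsm : ∀ᶠ q in 𝓝 ((u, 0) : ℝ × ℝ), |q.1 - u| + √|q.2| < δ := by
    have : ContinuousAt (fun q : ℝ × ℝ => |q.1 - u| + √|q.2|) (u, 0) := by fun_prop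
    exact this.eventually_lt continuousAt_const (by simpa using hδ)
  filter_upwards [hGC, hsm] with q hq hqδ
  obtain ⟨s, hs, hφ, hsn⟩ := phiHatC_apply Γ q j
  have e1 : C (q.1 + Complex.I * s) = Γ (q.1 + Complex.I * s) j := by
    refine hδC (lt_of_le_of_lt ?_ hqδ)
    rw [dist_eq_norm, add_sub_right_comm]
    refine (norm_add_le _ _).trans (le_of_eq ?_)
    rw [← ofReal_sub, norm_real, norm_mul, norm_I, one_mul, hsn, Real.norm_eq_abs]
  have e2 : C (q.1 - Complex.I * s) = Γ (q.1 - Complex.I * s) j := by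
    refine hδC (lt_of_le_of_lt ?_ hqδ)
    rw [dist_eq_norm, sub_right_comm]
    refine (norm_sub_le _ _).trans (le_of_eq ?_)
    rw [← ofReal_sub, norm_real, norm_mul, norm_I, one_mul, hsn, Real.norm_eq_abs]
  rw [hφ, hq s hs, e1, e2]

theorem phiHat_analyticAt {I : Set ℝ} {γ : ℝ → Mink} {U : Set ℂ}
    {Γ : ℂ → Fin 3 → ℂ} (h : IsHolomorphicExtension I γ U Γ) (hI : IsOpen I) {u : ℝ}
    (hu : u ∈ I) (hγ : AnalyticAt ℝ γ u) : AnalyticAt ℝ (phiHat Γ) (u, 0) := by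
  refine analyticAt_pi_iff.2 fun j => ?_
  obtain ⟨G, hG, hGe⟩ := exists_analyticAt_phiHatC h hI hu hγ j
  refine hG.congr ?_
  filter_upwards [hGe] with q hq
  simp [phiHat, hq]

theorem eventually_phiHatC_eq {I : Set ℝ} {γ : ℝ → Mink} {U : Set ℂ}
    {Γ : ℂ → Fin 3 → ℂ} (h : IsHolomorphicExtension I γ U Γ) (hI : IsOpen I) {u : ℝ}
    (hu : u ∈ I) (hγ : AnalyticAt ℝ γ u) :
    ∀ᶠ q in 𝓝 ((u, 0) : ℝ × ℝ), ∀ j, phiHatC Γ q j = (phiHat Γ q j : ℂ) := by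
  refine eventually_all.2 fun j => ?_
  obtain ⟨G, -, hGe⟩ := exists_analyticAt_phiHatC h hI hu hγ j
  filter_upwards [hGe] with q hq
  simp [phiHat, hq]

/-- On the time-like side `φ̂_γ` is the sum of two null curves. -/
theorem eventually_phiHat_neg_sq {I : Set ℝ} {γ : ℝ → Mink} {U : Set ℂ}
    {Γ : ℂ → Fin 3 → ℂ} (h : IsHolomorphicExtension I γ U Γ) (hI : IsOpen I) {u : ℝ}
    (hu : u ∈ I) (j : Fin 3) :
    ∀ᶠ q in 𝓝 ((u, 0) : ℝ × ℝ),
      phiHat Γ (q.1, -q.2 ^ 2) j = 2⁻¹ * (γ (q.1 + q.2) j + γ (q.1 - q.2) j) := by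
  have c1 : ContinuousAt (fun q : ℝ × ℝ => q.1 + q.2) (u, 0) := by fun_prop
  have c2 : ContinuousAt (fun q : ℝ × ℝ => q.1 - q.2) (u, 0) := by fun_prop
  filter_upwards [c1 (hI.mem_nhds (by simpa using hu)), c2 (hI.mem_nhds (by simpa using hu))]
    with q h1 h2
  have e1 := h.agree _ h1 j
  have e2 := h.agree _ h2 j
  by_cases hq : q.2 = 0
  · simp only [hq, add_zero, sub_zero] at e1 e2 ⊢
    simp [phiHat, phiHatC, e1]
  · have hlt : ¬ (0 ≤ -q.2 ^ 2) := by
      have : 0 < q.2 ^ 2 := by positivity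
      linarith
    have hs : √|-q.2 ^ 2| = |q.2| := by
      rw [abs_neg, abs_of_nonneg (sq_nonneg _), Real.sqrt_sq_eq_abs]
    simp only [phiHat, phiHatC, hlt, if_false, hs]
    rcases abs_cases q.2 with ⟨ha, -⟩ | ⟨ha, -⟩
    · rw [ha]
      simp only [Pi.smul_apply, Pi.add_apply, e1, e2]
      simp
    · rw [ha, ← sub_eq_add_neg, sub_neg_eq_add]
      simp only [Pi.smul_apply, Pi.add_apply, e1, e2]
      simp [add_comm]

theorem exists_ball_extension {γ : ℝ → Mink} {t : ℝ} (hγ : AnalyticAt ℝ γ t) :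
    ∃ (r : ℝ) (C : ℂ → Fin 3 → ℂ), 0 < r ∧
      (∀ z ∈ Metric.ball (t : ℂ) r, ∀ j, AnalyticAt ℂ (fun w => C w j) z) ∧
      ∀ x : ℝ, (x : ℂ) ∈ Metric.ball (t : ℂ) r → ∀ j, C x j = γ x j := by
  choose G C hG hC hCg hGC using
    fun j : Fin 3 => exists_analyticAt_even_part (analyticAt_pi_iff.1 hγ j)
  have h1 : ∀ᶠ z in 𝓝 (t : ℂ), ∀ j, AnalyticAt ℂ (C j) z :=
    eventually_all.2 fun j => (hC j).eventually_analyticAt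
  have h2 : ∀ᶠ x : ℝ in 𝓝 t, ∀ j, C j x = γ x j := eventually_all.2 hCg
  obtain ⟨r₁, hr₁, h1⟩ := Metric.eventually_nhds_iff.1 h1
  obtain ⟨r₂, hr₂, h2⟩ := Metric.eventually_nhds_iff.1 h2
  refine ⟨min r₁ r₂, fun z j => C j z, lt_min hr₁ hr₂, fun z hz j => ?_, fun x hx j => ?_⟩
  · exact h1 (lt_of_lt_of_le hz (min_le_left _ _)) j
  · refine h2 (lt_of_lt_of_le ?_ (min_le_right r₁ r₂)) j
    rw [Metric.mem_ball, dist_eq_norm, ← ofReal_sub, norm_real] at hx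
    exact hx

theorem re_mem_ball {t r : ℝ} {z : ℂ} (hz : z ∈ Metric.ball (t : ℂ) r) :
    ((z.re : ℝ) : ℂ) ∈ Metric.ball (t : ℂ) r := by
  rw [Metric.mem_ball] at hz ⊢
  refine lt_of_le_of_lt ?_ hz
  rw [dist_eq_norm, dist_eq_norm, ← ofReal_sub, norm_real]
  simpa using abs_re_le_norm (z - t)

/-- Taylor extensions on discs with real centres are glued. The intersection of two such discs is
convex and contains the real part of each of its points, so the two extensions agree on it by the
identity theorem. -/
theorem exists_holomorphicExtension {I : Set ℝ} {γ : ℝ → Mink} (hγ : AnalyticOnNhd ℝ γ I) :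
    ∃ (U : Set ℂ) (Γ : ℂ → Fin 3 → ℂ), IsHolomorphicExtension I γ U Γ := by
  classical
  choose r C hr hC hCγ using fun t : I => exists_ball_extension (hγ t t.2)
  have huniq : ∀ (s t : I) (z : ℂ), z ∈ Metric.ball ((s : ℝ) : ℂ) (r s) →
      z ∈ Metric.ball ((t : ℝ) : ℂ) (r t) → C s z = C t z := by
    intro s t z hs ht
    funext j
    have hconv : IsPreconnected (Metric.ball ((s : ℝ) : ℂ) (r s) ∩ Metric.ball ((t : ℝ) : ℂ) (r t)) :=
      ((convex_ball _ _).inter (convex_ball _ _)).isPreconnected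
    have hmem : ((z.re : ℝ) : ℂ) ∈ Metric.ball ((s : ℝ) : ℂ) (r s) ∩
        Metric.ball ((t : ℝ) : ℂ) (r t) := ⟨re_mem_ball hs, re_mem_ball ht⟩
    have hopen := (Metric.isOpen_ball (x := ((s : ℝ) : ℂ)) (ε := r s)).inter
      (Metric.isOpen_ball (x := ((t : ℝ) : ℂ)) (ε := r t))
    refine AnalyticOnNhd.eqOn_of_preconnected_of_eventuallyEq (f := fun z => C s z j)
      (g := fun z => C t z j) (fun w hw => hC s w hw.1 j) (fun w hw => hC t w hw.2 j) hconv hmem ?_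
      ⟨hs, ht⟩
    refine eventuallyEq_of_eventually_ofReal (hC s _ hmem.1 j) (hC t _ hmem.2 j) ?_
    filter_upwards [continuous_ofReal.continuousAt (hopen.mem_nhds hmem)] with x hx
    rw [hCγ s x hx.1 j, hCγ t x hx.2 j]
  let U : Set ℂ := ⋃ t : I, Metric.ball ((t : ℝ) : ℂ) (r t)
  have hU : IsOpen U := isOpen_iUnion fun t => Metric.isOpen_ball
  have hself : ∀ t : I, ((t : ℝ) : ℂ) ∈ Metric.ball ((t : ℝ) : ℂ) (r t) :=
    fun t => Metric.mem_ball_self (hr t)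
  let Γ : ℂ → Fin 3 → ℂ := fun z =>
    if h : ∃ t : I, z ∈ Metric.ball ((t : ℝ) : ℂ) (r t) then C h.choose z else 0
  have hΓ : ∀ (t : I) (z : ℂ), z ∈ Metric.ball ((t : ℝ) : ℂ) (r t) → Γ z = C t z := by
    intro t z hz
    have h : ∃ t : I, z ∈ Metric.ball ((t : ℝ) : ℂ) (r t) := ⟨t, hz⟩
    simp only [Γ, dif_pos h]
    exact huniq _ _ _ h.choose_spec hz
  refine ⟨U, Γ, hU, fun t ht => Set.mem_iUnion.2 ⟨⟨t, ht⟩, hself ⟨t, ht⟩⟩, ?_, ?_⟩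
  · intro z hz
    obtain ⟨t, ht⟩ := Set.mem_iUnion.1 hz
    refine DifferentiableAt.differentiableWithinAt ?_
    have h1 : DifferentiableAt ℂ (C t) z :=
      differentiableAt_pi.2 fun j => (hC t z ht j).differentiableAt
    refine h1.congr_of_eventuallyEq ?_
    filter_upwards [Metric.isOpen_ball.mem_nhds ht] with w hw using hΓ t w hw
  · intro t ht j
    rw [hΓ ⟨t, ht⟩ t (hself ⟨t, ht⟩)]
    exact hCγ ⟨t, ht⟩ t (hself ⟨t, ht⟩) j

/-! ### Calculus of partial derivatives -/

section Partial

variable {E : Type*} [NormedAddCommGroup E] [NormedSpace ℝ E]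

theorem hasDerivAt_comp_pair {F : ℝ × ℝ → E} {x y : ℝ → ℝ} {a b t : ℝ}
    (hF : DifferentiableAt ℝ F (x t, y t)) (hx : HasDerivAt x a t) (hy : HasDerivAt y b t) :
    HasDerivAt (fun t => F (x t, y t)) (a • d₁ F (x t, y t) + b • d₂ F (x t, y t)) t := by
  have h := hF.hasFDerivAt.comp_hasDerivAt t (hx.prodMk hy)
  have e : ((a, b) : ℝ × ℝ) = a • (1, 0) + b • (0, 1) := by simp
  rw [e, map_add, map_smul, map_smul] at h
  exact h

theorem hasDerivAt_d₁ {F : ℝ × ℝ → E} {q : ℝ × ℝ} (hF : DifferentiableAt ℝ F q) :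
    HasDerivAt (fun t => F (t, q.2)) (d₁ F q) q.1 := by
  simpa using hasDerivAt_comp_pair (t := q.1) hF (hasDerivAt_id _) (hasDerivAt_const _ q.2)

theorem hasDerivAt_d₂ {F : ℝ × ℝ → E} {q : ℝ × ℝ} (hF : DifferentiableAt ℝ F q) :
    HasDerivAt (fun t => F (q.1, t)) (d₂ F q) q.2 := by
  simpa using hasDerivAt_comp_pair (t := q.2) hF (hasDerivAt_const _ q.1) (hasDerivAt_id _)

theorem analyticAt_d₁ [CompleteSpace E] {F : ℝ × ℝ → E} {q : ℝ × ℝ} (hF : AnalyticAt ℝ F q) :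
    AnalyticAt ℝ (d₁ F) q :=
  (ContinuousLinearMap.apply ℝ E ((1, 0) : ℝ × ℝ)).analyticAt _ |>.fun_comp hF.fderiv

theorem analyticAt_d₂ [CompleteSpace E] {F : ℝ × ℝ → E} {q : ℝ × ℝ} (hF : AnalyticAt ℝ F q) :
    AnalyticAt ℝ (d₂ F) q :=
  (ContinuousLinearMap.apply ℝ E ((0, 1) : ℝ × ℝ)).analyticAt _ |>.fun_comp hF.fderiv

theorem d₂_congr {F G : ℝ × ℝ → E} {q : ℝ × ℝ} (h : F =ᶠ[𝓝 q] G) : d₂ F q = d₂ G q := by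
  rw [d₂, d₂, h.fderiv_eq]

theorem fderiv_eq_d₁_d₂ (F : ℝ × ℝ → E) (q w : ℝ × ℝ) :
    fderiv ℝ F q w = w.1 • d₁ F q + w.2 • d₂ F q := by
  have e : w = w.1 • ((1, 0) : ℝ × ℝ) + w.2 • ((0, 1) : ℝ × ℝ) := by simp
  conv_lhs => rw [e]
  rw [map_add, map_smul, map_smul]
  rfl

end Partial

theorem d₁_pi {φ : ℝ × ℝ → Mink} {q : ℝ × ℝ} (h : DifferentiableAt ℝ φ q) (j : Fin 3) :
    d₁ φ q j = d₁ (fun q => φ q j) q := by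
  have h1 := hasFDerivAt_pi'.1 h.hasFDerivAt j
  rw [d₁, d₁, h1.fderiv]
  rfl

theorem d₂_pi {φ : ℝ × ℝ → Mink} {q : ℝ × ℝ} (h : DifferentiableAt ℝ φ q) (j : Fin 3) :
    d₂ φ q j = d₂ (fun q => φ q j) q := by
  have h1 := hasFDerivAt_pi'.1 h.hasFDerivAt j
  rw [d₂, d₂, h1.fderiv]
  rfl

theorem tendsto_neg_sq (u : ℝ) :
    Tendsto (fun q : ℝ × ℝ => (q.1, -q.2 ^ 2)) (𝓝 (u, 0)) (𝓝 (u, 0)) := by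
  have : ContinuousAt (fun q : ℝ × ℝ => (q.1, -q.2 ^ 2)) (u, 0) := by fun_prop
  simpa [ContinuousAt] using this

theorem tendsto_fst_add_snd (u : ℝ) :
    Tendsto (fun q : ℝ × ℝ => q.1 + q.2) (𝓝 (u, 0)) (𝓝 u) := by
  have : ContinuousAt (fun q : ℝ × ℝ => q.1 + q.2) (u, 0) := by fun_prop
  simpa [ContinuousAt] using this

theorem tendsto_fst_sub_snd (u : ℝ) :
    Tendsto (fun q : ℝ × ℝ => q.1 - q.2) (𝓝 (u, 0)) (𝓝 u) := by
  have : ContinuousAt (fun q : ℝ × ℝ => q.1 - q.2) (u, 0) := by fun_prop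
  simpa [ContinuousAt] using this

theorem eventually_comp_snd {P : ℝ × ℝ → Prop} {q : ℝ × ℝ} (h : ∀ᶠ w in 𝓝 q, P w) :
    ∀ᶠ t in 𝓝 q.2, P (q.1, t) :=
  (Continuous.prodMk_right q.1).continuousAt.eventually h

theorem eventually_comp_fst {P : ℝ × ℝ → Prop} {q : ℝ × ℝ} (h : ∀ᶠ w in 𝓝 q, P w) :
    ∀ᶠ t in 𝓝 q.1, P (t, q.2) :=
  (Continuous.prodMk_left q.2).continuousAt.eventually h

/-! ### The substitution `v = -τ²` and continuation across `v = 0` -/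

section Even

variable {φ : ℝ × ℝ → ℝ} {g : ℝ → ℝ} {u : ℝ}

theorem eventually_d₁_neg_sq (hφ : AnalyticAt ℝ φ (u, 0)) (hg : AnalyticAt ℝ g u)
    (h : ∀ᶠ q in 𝓝 ((u, 0) : ℝ × ℝ),
      φ (q.1, -q.2 ^ 2) = 2⁻¹ * (g (q.1 + q.2) + g (q.1 - q.2))) :
    ∀ᶠ q in 𝓝 ((u, 0) : ℝ × ℝ),
      d₁ φ (q.1, -q.2 ^ 2) = 2⁻¹ * (deriv g (q.1 + q.2) + deriv g (q.1 - q.2)) := by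
  filter_upwards [h.eventually_nhds, (tendsto_neg_sq u).eventually hφ.eventually_analyticAt,
    (tendsto_fst_add_snd u).eventually hg.eventually_analyticAt,
    (tendsto_fst_sub_snd u).eventually hg.eventually_analyticAt] with q hq h1 h2 h3
  have e1 := hasDerivAt_d₁ h1.differentiableAt
  have e2 := ((h2.differentiableAt.hasDerivAt.comp_add_const q.1 q.2).add
    (h3.differentiableAt.hasDerivAt.comp_sub_const q.1 q.2)).const_mul 2⁻¹
  refine e1.unique (e2.congr_of_eventuallyEq ?_)
  filter_upwards [eventually_comp_fst hq] with t ht using ht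

theorem eventually_d₂_neg_sq (hφ : AnalyticAt ℝ φ (u, 0)) (hg : AnalyticAt ℝ g u)
    (h : ∀ᶠ q in 𝓝 ((u, 0) : ℝ × ℝ),
      φ (q.1, -q.2 ^ 2) = 2⁻¹ * (g (q.1 + q.2) + g (q.1 - q.2))) :
    ∀ᶠ q in 𝓝 ((u, 0) : ℝ × ℝ),
      -2 * q.2 * d₂ φ (q.1, -q.2 ^ 2) =
        2⁻¹ * (deriv g (q.1 + q.2) - deriv g (q.1 - q.2)) := by
  filter_upwards [h.eventually_nhds, (tendsto_neg_sq u).eventually hφ.eventually_analyticAt,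
    (tendsto_fst_add_snd u).eventually hg.eventually_analyticAt,
    (tendsto_fst_sub_snd u).eventually hg.eventually_analyticAt] with q hq h1 h2 h3
  have e0 : HasDerivAt (fun t : ℝ => -t ^ 2) (-2 * q.2) q.2 := by
    simpa using (hasDerivAt_pow 2 q.2).fun_neg
  have e1 := hasDerivAt_comp_pair (x := fun _ => q.1) (y := fun t => -t ^ 2) (t := q.2)
    h1.differentiableAt (hasDerivAt_const _ q.1) e0
  have e2 := ((h2.differentiableAt.hasDerivAt.comp_const_add q.1 q.2).add
    (h3.differentiableAt.hasDerivAt.comp_const_sub q.1 q.2)).const_mul 2⁻¹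
  have e3 := e1.unique (e2.congr_of_eventuallyEq
    (by filter_upwards [eventually_comp_snd hq] with t ht using ht))
  simp only [smul_eq_mul] at e3
  linear_combination e3

theorem eventually_d₂_d₂_neg_sq (hφ : AnalyticAt ℝ φ (u, 0)) (hg : AnalyticAt ℝ g u)
    (h : ∀ᶠ q in 𝓝 ((u, 0) : ℝ × ℝ),
      φ (q.1, -q.2 ^ 2) = 2⁻¹ * (g (q.1 + q.2) + g (q.1 - q.2))) :
    ∀ᶠ q in 𝓝 ((u, 0) : ℝ × ℝ),
      -2 * d₂ φ (q.1, -q.2 ^ 2) + 4 * q.2 ^ 2 * d₂ (d₂ φ) (q.1, -q.2 ^ 2) =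
        2⁻¹ * (deriv (deriv g) (q.1 + q.2) + deriv (deriv g) (q.1 - q.2)) := by
  have hg' := hg.deriv
  filter_upwards [(eventually_d₂_neg_sq hφ hg h).eventually_nhds,
    (tendsto_neg_sq u).eventually (analyticAt_d₂ hφ).eventually_analyticAt,
    (tendsto_fst_add_snd u).eventually hg'.eventually_analyticAt,
    (tendsto_fst_sub_snd u).eventually hg'.eventually_analyticAt] with q hq h1 h2 h3
  have e0 : HasDerivAt (fun t : ℝ => -t ^ 2) (-2 * q.2) q.2 := by
    simpa using (hasDerivAt_pow 2 q.2).fun_neg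
  have e1 := ((hasDerivAt_id q.2).const_mul (-2)).mul
    (hasDerivAt_comp_pair (x := fun _ => q.1) (y := fun t => -t ^ 2) (t := q.2)
      h1.differentiableAt (hasDerivAt_const _ q.1) e0)
  have e2 := ((h2.differentiableAt.hasDerivAt.comp_const_add q.1 q.2).sub
    (h3.differentiableAt.hasDerivAt.comp_const_sub q.1 q.2)).const_mul 2⁻¹
  have e3 := e1.unique (e2.congr_of_eventuallyEq
    (by filter_upwards [eventually_comp_snd hq] with t ht using ht))
  simp only [smul_eq_mul, id] at e3
  linear_combination e3

/-- The points `(u, -τ²)` with `τ ≠ 0` fill an open set on the side `v < 0`, and an analytic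
function vanishing there vanishes on a whole ball about `(u, 0)`. -/
theorem eventually_eq_zero_of_neg {G : ℝ × ℝ → ℝ} (hG : AnalyticAt ℝ G (u, 0))
    (h : ∀ᶠ q in 𝓝 ((u, 0) : ℝ × ℝ), q.2 ≠ 0 → G (q.1, -q.2 ^ 2) = 0) :
    ∀ᶠ q in 𝓝 ((u, 0) : ℝ × ℝ), G q = 0 := by
  obtain ⟨R, hR, hGR⟩ := Metric.eventually_nhds_iff_ball.1 hG.eventually_analyticAt
  obtain ⟨δ, hδ, hz⟩ := Metric.eventually_nhds_iff_ball.1 h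
  have hpre : IsPreconnected (Metric.ball ((u, 0) : ℝ × ℝ) R) := (convex_ball _ _).isPreconnected
  -- A base point on the negative side: `η < R` keeps it in the ball of analyticity, and `η < δ²`
  -- makes `τ = √(-v)` smaller than `δ` nearby.
  set η := min (δ ^ 2) R / 2 with hη
  have hη0 : 0 < η := by positivity
  have hηR : η < R := by
    have := min_le_right (δ ^ 2) R
    linarith
  have hηδ : η < δ ^ 2 := by
    have := min_le_left (δ ^ 2) R
    have : 0 < δ ^ 2 := by positivity
    linarith
  have hmem : ((u, -η) : ℝ × ℝ) ∈ Metric.ball ((u, 0) : ℝ × ℝ) R := by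
    simpa [Prod.dist_eq, Real.dist_eq, abs_of_pos hη0, hR] using hηR
  have hzero : G =ᶠ[𝓝 ((u, -η) : ℝ × ℝ)] 0 := by
    have c1 : ∀ᶠ q : ℝ × ℝ in 𝓝 (u, -η), |q.1 - u| < δ := by
      have : ContinuousAt (fun q : ℝ × ℝ => |q.1 - u|) (u, -η) := by fun_prop
      exact this.eventually_lt continuousAt_const (by simpa using hδ)
    have c2 : ∀ᶠ q : ℝ × ℝ in 𝓝 (u, -η), -q.2 < δ ^ 2 := by
      have : ContinuousAt (fun q : ℝ × ℝ => -q.2) (u, -η) := by fun_prop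
      exact this.eventually_lt continuousAt_const (by simpa using hηδ)
    have c3 : ∀ᶠ q : ℝ × ℝ in 𝓝 (u, -η), q.2 < 0 := by
      have : ContinuousAt (fun q : ℝ × ℝ => q.2) (u, -η) := by fun_prop
      exact this.eventually_lt continuousAt_const (by simpa using hη0)
    filter_upwards [c1, c2, c3] with q h1 h2 h3
    have hs : √(-q.2) < δ := by
      rw [Real.sqrt_lt' hδ]
      exact h2
    have := hz (q.1, √(-q.2)) (by
      simp [Prod.dist_eq, Real.dist_eq, abs_of_nonneg (Real.sqrt_nonneg _), h1, hs])
      (Real.sqrt_ne_zero'.2 (by linarith))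
    simpa [Real.sq_sqrt (by linarith : (0 : ℝ) ≤ -q.2)] using this
  have := AnalyticOnNhd.eqOn_zero_of_preconnected_of_eventuallyEq_zero (f := G) hGR hpre hmem hzero
  filter_upwards [Metric.ball_mem_nhds _ hR] with q hq using this hq

end Even

/-- The first and second order equations satisfied by `φ̂_γ` near a point `(u, 0)`. -/
structure EvenNullData (φ : ℝ × ℝ → Mink) (q : ℝ × ℝ) : Prop where
  wave : ∀ j, d₁ (d₁ φ) q j + 4 * q.2 * d₂ (d₂ φ) q j + 2 * d₂ φ q j = 0
  orth : lorentz (d₁ φ q) (d₂ φ q) = 0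
  conf : lorentz (d₁ φ q) (d₁ φ q) = 4 * q.2 * lorentz (d₂ φ q) (d₂ φ q)

/-- With `F = 0` and `E = 4vG` the numerator is `G(4vN + L)`, and by the wave equation `4vN + L =
-2⟨φ_v, ν⟩`, which is zero since `ν` is normal to `φ_v`. -/
theorem EvenNullData.meanCurvatureNumerator_eq_zero {φ : ℝ × ℝ → Mink} {q : ℝ × ℝ}
    (h : EvenNullData φ q) : meanCurvatureNumerator φ q = 0 := by
  have h0 := h.wave 0
  have h1 := h.wave 1
  have h2 := h.wave 2
  rw [meanCurvatureNumerator, h.orth, h.conf]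
  have hn : lorentz (d₂ φ q) (normal φ q) = 0 := by
    simp [lorentz, normal, lorentzCross]
    ring
  have e : 4 * q.2 * lorentz (d₂ (d₂ φ) q) (normal φ q) + lorentz (d₁ (d₁ φ) q) (normal φ q) =
      -2 * lorentz (d₂ φ q) (normal φ q) := by
    simp only [lorentz]
    linear_combination (-(normal φ q 0)) * h0 + normal φ q 1 * h1 + normal φ q 2 * h2
  linear_combination lorentz (d₂ φ q) (d₂ φ q) * (e - 2 * hn)

section EvenNull

variable {φ : ℝ × ℝ → Mink} {γ : ℝ → Mink} {u : ℝ}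

theorem deriv_apply_of_analyticAt {t : ℝ} (h : AnalyticAt ℝ γ t) (j : Fin 3) :
    deriv γ t j = deriv (fun s => γ s j) t := by
  have h1 := h.differentiableAt.hasDerivAt
  rw [hasDerivAt_pi] at h1
  exact (h1 j).deriv.symm

theorem lorentz_analyticAt {v w : ℝ × ℝ → Mink} {q : ℝ × ℝ} (hv : AnalyticAt ℝ v q)
    (hw : AnalyticAt ℝ w q) : AnalyticAt ℝ (fun q => lorentz (v q) (w q)) q := by
  have hv' := analyticAt_pi_iff.1 hv
  have hw' := analyticAt_pi_iff.1 hw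
  exact (((hv' 0).mul (hw' 0)).neg.add ((hv' 1).mul (hw' 1))).add ((hv' 2).mul (hw' 2))

theorem even_null_first_order (hφ : AnalyticAt ℝ φ (u, 0)) (hγ : AnalyticAt ℝ γ u)
    (h : ∀ j, ∀ᶠ q in 𝓝 ((u, 0) : ℝ × ℝ),
      φ (q.1, -q.2 ^ 2) j = 2⁻¹ * (γ (q.1 + q.2) j + γ (q.1 - q.2) j)) :
    ∀ᶠ q in 𝓝 ((u, 0) : ℝ × ℝ), ∀ j,
      d₁ φ (q.1, -q.2 ^ 2) j = 2⁻¹ * (deriv γ (q.1 + q.2) j + deriv γ (q.1 - q.2) j) ∧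
      -2 * q.2 * d₂ φ (q.1, -q.2 ^ 2) j =
        2⁻¹ * (deriv γ (q.1 + q.2) j - deriv γ (q.1 - q.2) j) := by
  refine eventually_all.2 fun j => ?_
  have hφj := analyticAt_pi_iff.1 hφ j
  have hγj := analyticAt_pi_iff.1 hγ j
  filter_upwards [eventually_d₁_neg_sq hφj hγj (h j), eventually_d₂_neg_sq hφj hγj (h j),
    (tendsto_neg_sq u).eventually hφ.eventually_analyticAt,
    (tendsto_fst_add_snd u).eventually hγ.eventually_analyticAt,
    (tendsto_fst_sub_snd u).eventually hγ.eventually_analyticAt] with q h1 h2 h3 h4 h5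
  rw [d₁_pi h3.differentiableAt, d₂_pi h3.differentiableAt, deriv_apply_of_analyticAt h4,
    deriv_apply_of_analyticAt h5]
  exact ⟨h1, h2⟩

theorem even_null_second_order (hφ : AnalyticAt ℝ φ (u, 0)) (hγ : AnalyticAt ℝ γ u)
    (h : ∀ j, ∀ᶠ q in 𝓝 ((u, 0) : ℝ × ℝ),
      φ (q.1, -q.2 ^ 2) j = 2⁻¹ * (γ (q.1 + q.2) j + γ (q.1 - q.2) j)) :
    ∀ᶠ q in 𝓝 ((u, 0) : ℝ × ℝ), ∀ j,
      d₁ (d₁ φ) (q.1, -q.2 ^ 2) j =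
        2⁻¹ * (deriv (deriv γ) (q.1 + q.2) j + deriv (deriv γ) (q.1 - q.2) j) ∧
      -2 * d₂ φ (q.1, -q.2 ^ 2) j + 4 * q.2 ^ 2 * d₂ (d₂ φ) (q.1, -q.2 ^ 2) j =
        2⁻¹ * (deriv (deriv γ) (q.1 + q.2) j + deriv (deriv γ) (q.1 - q.2) j) := by
  refine eventually_all.2 fun j => ?_
  have hφj := analyticAt_pi_iff.1 hφ j
  have hγj := analyticAt_pi_iff.1 hγ j
  have hfirst : ∀ᶠ q in 𝓝 ((u, 0) : ℝ × ℝ), d₁ φ (q.1, -q.2 ^ 2) j =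
      2⁻¹ * (deriv γ (q.1 + q.2) j + deriv γ (q.1 - q.2) j) := by
    filter_upwards [even_null_first_order hφ hγ h] with q hq using (hq j).1
  have hj : ∀ᶠ t in 𝓝 u, deriv (fun s => γ s j) t = deriv γ t j := by
    filter_upwards [hγ.eventually_analyticAt] with t ht using (deriv_apply_of_analyticAt ht j).symm
  have hd₂j : ∀ᶠ q in 𝓝 ((u, 0) : ℝ × ℝ), d₂ (fun q => φ q j) q = d₂ φ q j := by
    filter_upwards [hφ.eventually_analyticAt] with q hq using (d₂_pi hq.differentiableAt j).symm
  have hφ1 := analyticAt_d₁ hφ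
  have hφ2 := analyticAt_d₂ hφ
  filter_upwards [eventually_d₁_neg_sq (analyticAt_pi_iff.1 hφ1 j)
      (analyticAt_pi_iff.1 hγ.deriv j) hfirst, eventually_d₂_d₂_neg_sq hφj hγj (h j),
    (tendsto_neg_sq u).eventually hφ1.eventually_analyticAt,
    (tendsto_neg_sq u).eventually hφ2.eventually_analyticAt,
    (tendsto_neg_sq u).eventually hd₂j.eventually_nhds,
    (tendsto_fst_add_snd u).eventually hγ.deriv.eventually_analyticAt,
    (tendsto_fst_sub_snd u).eventually hγ.deriv.eventually_analyticAt,
    (tendsto_fst_add_snd u).eventually hj.eventually_nhds,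
    (tendsto_fst_sub_snd u).eventually hj.eventually_nhds] with q h1 h2 h3 h4 h5 h6 h7 h8 h9
  rw [d₁_pi h3.differentiableAt, d₂_pi h4.differentiableAt, deriv_apply_of_analyticAt h6,
    deriv_apply_of_analyticAt h7]
  refine ⟨h1, ?_⟩
  rw [EventuallyEq.deriv_eq h8, EventuallyEq.deriv_eq h9, d₂_congr h5, h5.self_of_nhds] at h2
  exact h2

/-- At `τ = 0` the `φ_vv` term drops out of the second order identity, leaving `-2φ_v = γ''`. -/
theorem even_null_at_zero (hφ : AnalyticAt ℝ φ (u, 0)) (hγ : AnalyticAt ℝ γ u)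
    (h : ∀ j, ∀ᶠ q in 𝓝 ((u, 0) : ℝ × ℝ),
      φ (q.1, -q.2 ^ 2) j = 2⁻¹ * (γ (q.1 + q.2) j + γ (q.1 - q.2) j)) :
    (∀ j, d₁ φ (u, 0) j = deriv γ u j) ∧ ∀ j, d₂ φ (u, 0) j = -2⁻¹ * deriv (deriv γ) u j := by
  have h1 := (even_null_first_order hφ hγ h).self_of_nhds
  have h2 := (even_null_second_order hφ hγ h).self_of_nhds
  simp only [add_zero, sub_zero, ne_eq, OfNat.ofNat_ne_zero, not_false_eq_true, zero_pow, neg_zero,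
    mul_zero, zero_mul] at h1 h2
  refine ⟨fun j => ?_, fun j => ?_⟩
  · linear_combination (h1 j).1
  · linear_combination (-2⁻¹) * (h2 j).2

/-- For `τ ≠ 0` put `a = γ'(u+τ)` and `b = γ'(u-τ)`. Nullity gives `⟨a+b, a-b⟩ = 0` and `⟨a+b, a+b⟩
= -⟨a-b, a-b⟩`, and `φ_u` and `-2τφ_v` are half of `a+b` and `a-b`. All three relations are analytic
in `(u, v)`, so they continue to both sides. -/
theorem eventually_evenNullData (hφ : AnalyticAt ℝ φ (u, 0)) (hγ : AnalyticAt ℝ γ u)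
    (hnull : ∀ᶠ t in 𝓝 u, lorentz (deriv γ t) (deriv γ t) = 0)
    (h : ∀ j, ∀ᶠ q in 𝓝 ((u, 0) : ℝ × ℝ),
      φ (q.1, -q.2 ^ 2) j = 2⁻¹ * (γ (q.1 + q.2) j + γ (q.1 - q.2) j)) :
    ∀ᶠ q in 𝓝 ((u, 0) : ℝ × ℝ), EvenNullData φ q := by
  have hφ1 := analyticAt_d₁ hφ
  have hφ2 := analyticAt_d₂ hφ
  have hφ11 := analyticAt_d₁ hφ1
  have hφ22 := analyticAt_d₂ hφ2
  have w : ∀ᶠ q in 𝓝 ((u, 0) : ℝ × ℝ), ∀ j,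
      d₁ (d₁ φ) q j + 4 * q.2 * d₂ (d₂ φ) q j + 2 * d₂ φ q j = 0 := by
    refine eventually_all.2 fun j => ?_
    refine eventually_eq_zero_of_neg (((analyticAt_pi_iff.1 hφ11 j).add
      ((analyticAt_const.mul analyticAt_snd).mul (analyticAt_pi_iff.1 hφ22 j))).add
      (analyticAt_const.mul (analyticAt_pi_iff.1 hφ2 j))) ?_
    filter_upwards [even_null_second_order hφ hγ h] with q hq _
    linear_combination (hq j).1 - (hq j).2
  have hn1 := (tendsto_fst_add_snd u).eventually hnull
  have hn2 := (tendsto_fst_sub_snd u).eventually hnull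
  have o : ∀ᶠ q in 𝓝 ((u, 0) : ℝ × ℝ), lorentz (d₁ φ q) (d₂ φ q) = 0 := by
    refine eventually_eq_zero_of_neg (lorentz_analyticAt hφ1 hφ2) ?_
    filter_upwards [even_null_first_order hφ hγ h, hn1, hn2] with q hq h1 h2 hne
    have : -2 * q.2 * lorentz (d₁ φ (q.1, -q.2 ^ 2)) (d₂ φ (q.1, -q.2 ^ 2)) = 0 := by
      have a0 := (hq 0).2
      have a1 := (hq 1).2
      have a2 := (hq 2).2
      simp only [lorentz] at h1 h2 ⊢
      rw [(hq 0).1, (hq 1).1, (hq 2).1]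
      linear_combination (-(2⁻¹ * (deriv γ (q.1 + q.2) 0 + deriv γ (q.1 - q.2) 0))) * a0 +
        (2⁻¹ * (deriv γ (q.1 + q.2) 1 + deriv γ (q.1 - q.2) 1)) * a1 +
        (2⁻¹ * (deriv γ (q.1 + q.2) 2 + deriv γ (q.1 - q.2) 2)) * a2 + 4⁻¹ * h1 - 4⁻¹ * h2
    simpa [hne] using this
  have c : ∀ᶠ q in 𝓝 ((u, 0) : ℝ × ℝ),
      lorentz (d₁ φ q) (d₁ φ q) - 4 * q.2 * lorentz (d₂ φ q) (d₂ φ q) = 0 := by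
    refine eventually_eq_zero_of_neg ((lorentz_analyticAt hφ1 hφ1).sub
      ((analyticAt_const.mul analyticAt_snd).mul (lorentz_analyticAt hφ2 hφ2))) ?_
    filter_upwards [even_null_first_order hφ hγ h, hn1, hn2] with q hq h1 h2 _
    have a : ∀ j, 4 * q.2 ^ 2 * d₂ φ (q.1, -q.2 ^ 2) j ^ 2 =
        (2⁻¹ * (deriv γ (q.1 + q.2) j - deriv γ (q.1 - q.2) j)) ^ 2 := by
      intro j
      rw [← (hq j).2]
      ring
    simp only [lorentz] at h1 h2 ⊢
    rw [(hq 0).1, (hq 1).1, (hq 2).1]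
    linear_combination -a 0 + a 1 + a 2 + 2⁻¹ * h1 + 2⁻¹ * h2
  filter_upwards [w, o, c] with q hw ho hc
  exact ⟨hw, ho, by linarith⟩

end EvenNull

/-! ### Inverse functions, and surfaces as graphs -/

/-- The class `n` is kept general: the projection to the `xy`-plane is inverted with `n = ω`, the
gradient map with `n = 2`. -/
theorem exists_openPartialHomeomorph {X : ℝ × ℝ → ℝ × ℝ} {q₀ : ℝ × ℝ} {n : WithTop ℕ∞}
    (hX : ContDiffAt ℝ n X q₀) (hn : n ≠ 0) (hinj : Function.Injective (fderiv ℝ X q₀)) :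
    ∃ e : OpenPartialHomeomorph (ℝ × ℝ) (ℝ × ℝ), (∀ q, e q = X q) ∧ q₀ ∈ e.source ∧
      ContDiffAt ℝ n e.symm (X q₀) := by
  let L : (ℝ × ℝ) ≃L[ℝ] (ℝ × ℝ) :=
    (LinearEquiv.ofInjectiveEndo (fderiv ℝ X q₀ : ℝ × ℝ →ₗ[ℝ] ℝ × ℝ) hinj).toContinuousLinearEquiv
  have hL : HasFDerivAt X (L : ℝ × ℝ →L[ℝ] ℝ × ℝ) q₀ := by
    have h := (hX.differentiableAt hn).hasFDerivAt
    convert! h using 1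
  exact ⟨hX.toOpenPartialHomeomorph X hL hn, fun q => rfl,
    hX.mem_toOpenPartialHomeomorph_source hL hn, hX.to_localInverse hL hn⟩

theorem d₂_d₁_comm {f : ℝ × ℝ → ℝ} {q : ℝ × ℝ} (hf : ContDiffAt ℝ 2 f q) :
    d₂ (d₁ f) q = d₁ (d₂ f) q := by
  have hd : DifferentiableAt ℝ (fderiv ℝ f) q :=
    (hf.fderiv_right (m := 1) (by norm_num)).differentiableAt (by norm_num)
  have h1 : ∀ v w : ℝ × ℝ, fderiv ℝ (fun q => fderiv ℝ f q v) q w = fderiv ℝ (fderiv ℝ f) q w v := by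
    intro v w
    rw [fderiv_clm_apply hd (by fun_prop)]
    simp
  have hs := hf.isSymmSndFDerivAt (by simp)
  simp only [d₁, d₂]
  erw [h1, h1]
  exact hs _ _

/-- Derivative of `s ↦ Df(c(s)) c'(s)` along a curve `c = (x, y)`. -/
theorem hasDerivAt_second {f : ℝ × ℝ → ℝ} {x y x' y' : ℝ → ℝ} {a b t : ℝ}
    (h1 : DifferentiableAt ℝ (d₁ f) (x t, y t)) (h2 : DifferentiableAt ℝ (d₂ f) (x t, y t))
    (hx : HasDerivAt x (x' t) t) (hy : HasDerivAt y (y' t) t)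
    (hx' : HasDerivAt x' a t) (hy' : HasDerivAt y' b t) :
    HasDerivAt (fun s => x' s * d₁ f (x s, y s) + y' s * d₂ f (x s, y s))
      (a * d₁ f (x t, y t) + b * d₂ f (x t, y t) +
        x' t * (x' t * d₁ (d₁ f) (x t, y t) + y' t * d₂ (d₁ f) (x t, y t)) +
        y' t * (x' t * d₁ (d₂ f) (x t, y t) + y' t * d₂ (d₂ f) (x t, y t))) t := by
  refine ((hx'.mul (hasDerivAt_comp_pair h1 hx hy)).add
    (hy'.mul (hasDerivAt_comp_pair h2 hx hy))).congr_deriv ?_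
  simp only [smul_eq_mul]
  ring

/-- The projection of a surface to the `xy`-plane. -/
def proj (φ : ℝ × ℝ → Mink) (q : ℝ × ℝ) : ℝ × ℝ := (φ q 1, φ q 2)

/-- The Jacobian determinant of the projection of a surface to the `xy`-plane. -/
noncomputable def jac (φ : ℝ × ℝ → Mink) (q : ℝ × ℝ) : ℝ := d₁ φ q 1 * d₂ φ q 2 - d₁ φ q 2 * d₂ φ q 1

section Graph

variable {φ : ℝ × ℝ → Mink} {q : ℝ × ℝ} {f : ℝ × ℝ → ℝ}

theorem proj_analyticAt (hφ : AnalyticAt ℝ φ q) : AnalyticAt ℝ (proj φ) q :=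
  (analyticAt_pi_iff.1 hφ 1).prod (analyticAt_pi_iff.1 hφ 2)

theorem jac_analyticAt (hφ : AnalyticAt ℝ φ q) : AnalyticAt ℝ (jac φ) q := by
  have h1 := analyticAt_pi_iff.1 (analyticAt_d₁ hφ)
  have h2 := analyticAt_pi_iff.1 (analyticAt_d₂ hφ)
  exact ((h1 1).mul (h2 2)).sub ((h1 2).mul (h2 1))

theorem hasDerivAt_d₁_apply (hφ : DifferentiableAt ℝ φ q) (j : Fin 3) :
    HasDerivAt (fun t => φ (t, q.2) j) (d₁ φ q j) q.1 :=
  hasDerivAt_pi.1 (hasDerivAt_d₁ hφ) j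

theorem hasDerivAt_d₂_apply (hφ : DifferentiableAt ℝ φ q) (j : Fin 3) :
    HasDerivAt (fun t => φ (q.1, t) j) (d₂ φ q j) q.2 :=
  hasDerivAt_pi.1 (hasDerivAt_d₂ hφ) j

theorem injective_fderiv_of_jac_ne_zero (hj : jac φ q ≠ 0) :
    Function.Injective (fderiv ℝ φ q) := by
  rw [injective_iff_map_eq_zero]
  intro w hw
  rw [fderiv_eq_d₁_d₂] at hw
  have h1 := congrFun hw 1
  have h2 := congrFun hw 2
  simp only [Pi.add_apply, Pi.smul_apply, smul_eq_mul, Pi.zero_apply] at h1 h2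
  have e1 : w.1 * jac φ q = 0 := by
    rw [jac]
    linear_combination d₂ φ q 2 * h1 - d₂ φ q 1 * h2
  have e2 : w.2 * jac φ q = 0 := by
    rw [jac]
    linear_combination d₁ φ q 1 * h2 - d₁ φ q 2 * h1
  ext
  · simpa [hj] using e1
  · simpa [hj] using e2

theorem fderiv_proj_apply (hφ : DifferentiableAt ℝ φ q) (w : ℝ × ℝ) :
    fderiv ℝ (proj φ) q w = (fderiv ℝ φ q w 1, fderiv ℝ φ q w 2) := by
  have h := hasFDerivAt_pi'.1 hφ.hasFDerivAt
  have h3 : HasFDerivAt (proj φ) _ q := (h 1).prodMk (h 2)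
  rw [h3.fderiv]
  rfl

theorem injective_fderiv_proj (hφ : DifferentiableAt ℝ φ q) (hj : jac φ q ≠ 0) :
    Function.Injective (fderiv ℝ (proj φ) q) := by
  rw [injective_iff_map_eq_zero]
  intro w hw
  rw [fderiv_proj_apply hφ, fderiv_eq_d₁_d₂] at hw
  have h1 := congrArg Prod.fst hw
  have h2 := congrArg Prod.snd hw
  simp only [Pi.add_apply, Pi.smul_apply, smul_eq_mul, Prod.fst_zero, Prod.snd_zero] at h1 h2
  have e1 : w.1 * jac φ q = 0 := by
    rw [jac]
    linear_combination d₂ φ q 2 * h1 - d₂ φ q 1 * h2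
  have e2 : w.2 * jac φ q = 0 := by
    rw [jac]
    linear_combination d₁ φ q 1 * h2 - d₁ φ q 2 * h1
  ext
  · simpa [hj] using e1
  · simpa [hj] using e2

theorem graph_d₁ (hφ : DifferentiableAt ℝ φ q) (hf : DifferentiableAt ℝ f (proj φ q))
    (h : ∀ᶠ w in 𝓝 q, φ w 0 = f (proj φ w)) :
    d₁ φ q 0 = d₁ φ q 1 * d₁ f (proj φ q) + d₁ φ q 2 * d₂ f (proj φ q) := by
  have e := hasDerivAt_comp_pair (F := f) (t := q.1) hf (hasDerivAt_d₁_apply hφ 1)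
    (hasDerivAt_d₁_apply hφ 2)
  exact (hasDerivAt_d₁_apply hφ 0).unique (e.congr_of_eventuallyEq
    (by filter_upwards [eventually_comp_fst h] with t ht using ht))

theorem graph_d₂ (hφ : DifferentiableAt ℝ φ q) (hf : DifferentiableAt ℝ f (proj φ q))
    (h : ∀ᶠ w in 𝓝 q, φ w 0 = f (proj φ w)) :
    d₂ φ q 0 = d₂ φ q 1 * d₁ f (proj φ q) + d₂ φ q 2 * d₂ f (proj φ q) := by
  have e := hasDerivAt_comp_pair (F := f) (t := q.2) hf (hasDerivAt_d₂_apply hφ 1)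
    (hasDerivAt_d₂_apply hφ 2)
  exact (hasDerivAt_d₂_apply hφ 0).unique (e.congr_of_eventuallyEq
    (by filter_upwards [eventually_comp_snd h] with t ht using ht))

theorem graph_d₁_d₁ (hφ : AnalyticAt ℝ φ q) (hf : AnalyticAt ℝ f (proj φ q))
    (h : ∀ᶠ w in 𝓝 q, φ w 0 = f (proj φ w)) :
    d₁ (d₁ φ) q 0 = d₁ (d₁ φ) q 1 * d₁ f (proj φ q) + d₁ (d₁ φ) q 2 * d₂ f (proj φ q) +
      d₁ φ q 1 * (d₁ φ q 1 * d₁ (d₁ f) (proj φ q) + d₁ φ q 2 * d₂ (d₁ f) (proj φ q)) +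
      d₁ φ q 2 * (d₁ φ q 1 * d₁ (d₂ f) (proj φ q) + d₁ φ q 2 * d₂ (d₂ f) (proj φ q)) := by
  have hφ1 := (analyticAt_d₁ hφ).differentiableAt
  have hev : ∀ᶠ w in 𝓝 q,
      d₁ φ w 0 = d₁ φ w 1 * d₁ f (proj φ w) + d₁ φ w 2 * d₂ f (proj φ w) := by
    filter_upwards [h.eventually_nhds, hφ.eventually_analyticAt,
      (proj_analyticAt hφ).continuousAt.eventually hf.eventually_analyticAt] with w h1 h2 h3
    exact graph_d₁ h2.differentiableAt h3.differentiableAt h1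
  have e := hasDerivAt_second (f := f) (t := q.1) (x' := fun t => d₁ φ (t, q.2) 1)
    (y' := fun t => d₁ φ (t, q.2) 2) (analyticAt_d₁ hf).differentiableAt
    (analyticAt_d₂ hf).differentiableAt
    (hasDerivAt_d₁_apply hφ.differentiableAt 1) (hasDerivAt_d₁_apply hφ.differentiableAt 2)
    (hasDerivAt_d₁_apply hφ1 1) (hasDerivAt_d₁_apply hφ1 2)
  exact (hasDerivAt_d₁_apply hφ1 0).unique (e.congr_of_eventuallyEq
    (by filter_upwards [eventually_comp_fst hev] with t ht using ht))

theorem graph_d₂_d₂ (hφ : AnalyticAt ℝ φ q) (hf : AnalyticAt ℝ f (proj φ q))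
    (h : ∀ᶠ w in 𝓝 q, φ w 0 = f (proj φ w)) :
    d₂ (d₂ φ) q 0 = d₂ (d₂ φ) q 1 * d₁ f (proj φ q) + d₂ (d₂ φ) q 2 * d₂ f (proj φ q) +
      d₂ φ q 1 * (d₂ φ q 1 * d₁ (d₁ f) (proj φ q) + d₂ φ q 2 * d₂ (d₁ f) (proj φ q)) +
      d₂ φ q 2 * (d₂ φ q 1 * d₁ (d₂ f) (proj φ q) + d₂ φ q 2 * d₂ (d₂ f) (proj φ q)) := by
  have hφ2 := (analyticAt_d₂ hφ).differentiableAt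
  have hev : ∀ᶠ w in 𝓝 q,
      d₂ φ w 0 = d₂ φ w 1 * d₁ f (proj φ w) + d₂ φ w 2 * d₂ f (proj φ w) := by
    filter_upwards [h.eventually_nhds, hφ.eventually_analyticAt,
      (proj_analyticAt hφ).continuousAt.eventually hf.eventually_analyticAt] with w h1 h2 h3
    exact graph_d₂ h2.differentiableAt h3.differentiableAt h1
  have e := hasDerivAt_second (f := f) (t := q.2) (x' := fun t => d₂ φ (q.1, t) 1)
    (y' := fun t => d₂ φ (q.1, t) 2) (analyticAt_d₁ hf).differentiableAt
    (analyticAt_d₂ hf).differentiableAt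
    (hasDerivAt_d₂_apply hφ.differentiableAt 1) (hasDerivAt_d₂_apply hφ.differentiableAt 2)
    (hasDerivAt_d₂_apply hφ2 1) (hasDerivAt_d₂_apply hφ2 2)
  exact (hasDerivAt_d₂_apply hφ2 0).unique (e.congr_of_eventuallyEq
    (by filter_upwards [eventually_comp_snd hev] with t ht using ht))

/-- Let `Q` be the Hessian form of `f`, and `X_u`, `X_v` the projected tangent vectors. The
combination `G Q(X_u,X_u) - 2F Q(X_u,X_v) + E Q(X_v,X_v)` is `J²` times the left side of the
equation for `f`. With `F = 0` and `E = 4vG` it equals `G (Q(X_u,X_u) + 4v Q(X_v,X_v))`. -/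
theorem EvenNullData.graph_equation (hE : EvenNullData φ q) (hj : jac φ q ≠ 0)
    (hφ : AnalyticAt ℝ φ q) (hf : AnalyticAt ℝ f (proj φ q))
    (h : ∀ᶠ w in 𝓝 q, φ w 0 = f (proj φ w)) :
    (1 - d₂ f (proj φ q) ^ 2) * d₁ (d₁ f) (proj φ q) +
      2 * d₁ f (proj φ q) * d₂ f (proj φ q) * d₂ (d₁ f) (proj φ q) +
      (1 - d₁ f (proj φ q) ^ 2) * d₂ (d₂ f) (proj φ q) = 0 := by
  have w0 := hE.wave 0
  have w1 := hE.wave 1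
  have w2 := hE.wave 2
  have ho := hE.orth
  have hc := hE.conf
  have hs : d₁ (d₂ f) (proj φ q) = d₂ (d₁ f) (proj φ q) := (d₂_d₁_comm hf.contDiffAt).symm
  rw [graph_d₁_d₁ hφ hf h, graph_d₂_d₂ hφ hf h, graph_d₂ hφ.differentiableAt hf.differentiableAt h,
    hs] at w0
  simp only [lorentz] at ho hc
  rw [graph_d₁ hφ.differentiableAt hf.differentiableAt h,
    graph_d₂ hφ.differentiableAt hf.differentiableAt h] at ho hc
  rw [jac] at hj
  generalize d₁ f (proj φ q) = a at *
  generalize d₂ f (proj φ q) = b at *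
  generalize d₁ (d₁ f) (proj φ q) = r at *
  generalize d₂ (d₁ f) (proj φ q) = s at *
  generalize d₂ (d₂ f) (proj φ q) = t at *
  generalize d₁ φ q 1 = xu at *
  generalize d₁ φ q 2 = yu at *
  generalize d₂ φ q 1 = xv at *
  generalize d₂ φ q 2 = yv at *
  -- Subtracting `f_x` and `f_y` times the wave equations of `x` and `y` from that of the height
  -- removes everything but the Hessian terms.
  have hQ : (r * xu ^ 2 + 2 * s * xu * yu + t * yu ^ 2) +
      4 * q.2 * (r * xv ^ 2 + 2 * s * xv * yv + t * yv ^ 2) = 0 := by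
    linear_combination w0 - a * w1 - b * w2
  have key : (xu * yv - yu * xv) ^ 2 *
      ((1 - b ^ 2) * r + 2 * a * b * s + (1 - a ^ 2) * t) = 0 := by
    linear_combination (-(xv * a + yv * b) ^ 2 + xv ^ 2 + yv ^ 2) * hQ +
      (-2 * (r * xu * xv + s * (xu * yv + xv * yu) + t * yu * yv)) * ho +
      (r * xv ^ 2 + 2 * s * xv * yv + t * yv ^ 2) * hc
  exact (mul_eq_zero.1 key).resolve_left (pow_ne_zero 2 hj)

/-- `B` is the determinant of the metric of the graph in `(x, y)`, so `EG - F² = J²B`. -/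
theorem EvenNullData.jac_sq_mul_typeFun (hE : EvenNullData φ q)
    (hφ : DifferentiableAt ℝ φ q) (hf : DifferentiableAt ℝ f (proj φ q))
    (h : ∀ᶠ w in 𝓝 q, φ w 0 = f (proj φ w)) :
    jac φ q ^ 2 * typeFun f (proj φ q) = 4 * q.2 * lorentz (d₂ φ q) (d₂ φ q) ^ 2 := by
  have ho := hE.orth
  have hc := hE.conf
  simp only [lorentz, typeFun, jac] at ho hc ⊢
  rw [graph_d₁ hφ hf h, graph_d₂ hφ hf h] at ho hc
  rw [graph_d₂ hφ hf h]
  generalize d₁ f (proj φ q) = a at *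
  generalize d₂ f (proj φ q) = b at *
  generalize d₁ φ q 1 = xu at *
  generalize d₁ φ q 2 = yu at *
  generalize d₂ φ q 1 = xv at *
  generalize d₂ φ q 2 = yv at *
  linear_combination (-(xv * a + yv * b) ^ 2 + xv ^ 2 + yv ^ 2) * hc -
    (-((xu * a + yu * b) * (xv * a + yv * b)) + xu * xv + yu * yv) * ho

theorem typeFun_analyticAt {z : ℝ × ℝ} (hf : AnalyticAt ℝ f z) : AnalyticAt ℝ (typeFun f) z :=
  (analyticAt_const.sub ((analyticAt_d₁ hf).pow 2)).sub ((analyticAt_d₂ hf).pow 2)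

/-- Differentiate `J²B = 4vG²` in `v` at `v = 0`. As `B = 0` there, this reads `J² dB(X_v) = 4G²`,
which is not zero. -/
theorem isNondegenerateTypeChange_of_evenNullData {u : ℝ}
    (hE : ∀ᶠ q in 𝓝 ((u, 0) : ℝ × ℝ), EvenNullData φ q) (hj : jac φ (u, 0) ≠ 0)
    (hG : lorentz (d₂ φ (u, 0)) (d₂ φ (u, 0)) ≠ 0)
    (hφ : AnalyticAt ℝ φ (u, 0)) (hf : AnalyticAt ℝ f (proj φ (u, 0)))
    (h : ∀ᶠ w in 𝓝 ((u, 0) : ℝ × ℝ), φ w 0 = f (proj φ w)) :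
    IsNondegenerateTypeChange f (proj φ (u, 0)) := by
  have hev : ∀ᶠ q in 𝓝 ((u, 0) : ℝ × ℝ), jac φ q ^ 2 * typeFun f (proj φ q) =
      4 * q.2 * lorentz (d₂ φ q) (d₂ φ q) ^ 2 := by
    filter_upwards [hE, h.eventually_nhds, hφ.eventually_analyticAt,
      (proj_analyticAt hφ).continuousAt.eventually hf.eventually_analyticAt] with w h0 h1 h2 h3
    exact h0.jac_sq_mul_typeFun h2.differentiableAt h3.differentiableAt h1
  have h0 : typeFun f (proj φ (u, 0)) = 0 := by
    have := hev.self_of_nhds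
    simpa [hj] using this
  refine ⟨h0, fun hz => ?_⟩
  simp only [Prod.mk.injEq] at hz
  have hB := hasDerivAt_comp_pair (F := typeFun f) (t := (0 : ℝ))
    (typeFun_analyticAt hf).differentiableAt (hasDerivAt_d₂_apply hφ.differentiableAt 1)
    (hasDerivAt_d₂_apply hφ.differentiableAt 2)
  have hJ := hasDerivAt_d₂ ((jac_analyticAt hφ).pow 2).differentiableAt
  have hLz := hasDerivAt_d₂ ((lorentz_analyticAt (analyticAt_d₂ hφ) (analyticAt_d₂ hφ)).pow
    2).differentiableAt
  have hl := hJ.mul hB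
  have hr := ((hasDerivAt_id (0 : ℝ)).const_mul 4).mul hLz
  have e := hl.unique (hr.congr_of_eventuallyEq
    (by filter_upwards [eventually_comp_snd hev] with t ht using ht))
  change _ + _ * (d₂ φ (u, 0) 1 • d₁ (typeFun f) (proj φ (u, 0)) +
    d₂ φ (u, 0) 2 • d₂ (typeFun f) (proj φ (u, 0))) = _ at e
  rw [hz.1, hz.2] at e
  change _ * typeFun f (proj φ (u, 0)) + _ = _ at e
  rw [h0] at e
  simp [hG] at e

end Graph

/-! ### Linear algebra of a null vector and its orthogonal complement -/

section Algebra

variable {v w : Mink}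

/-- A nonzero null `v` has `v₀ ≠ 0`. If the `xy`-projections were dependent, nullity and
orthogonality would force `w = (w₀/v₀) v`. -/
theorem det_ne_zero_of_null (hv : v ≠ 0) (hvv : lorentz v v = 0) (hvw : lorentz v w = 0)
    (hw : ¬ ∃ k : ℝ, w = k • v) : v 1 * w 2 - v 2 * w 1 ≠ 0 := by
  intro h
  apply hw
  simp only [lorentz] at hvv hvw
  have h0 : v 0 ≠ 0 := by
    intro h0
    have h1 : v 1 = 0 := by nlinarith [sq_nonneg (v 1), sq_nonneg (v 2)]
    have h2 : v 2 = 0 := by nlinarith [sq_nonneg (v 1), sq_nonneg (v 2)]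
    exact hv (by ext j; fin_cases j <;> simp [h0, h1, h2])
  have h00 : v 0 ^ 2 ≠ 0 := pow_ne_zero 2 h0
  refine ⟨w 0 / v 0, ?_⟩
  ext j
  fin_cases j
  · simp [h0]
  · simp only [Fin.mk_one, Pi.smul_apply, smul_eq_mul]
    rw [div_mul_eq_mul_div, eq_div_iff h0]
    refine mul_left_cancel₀ h0 ?_
    linear_combination (-w 1) * hvv + v 1 * hvw - v 2 * h
  · simp only [Fin.reduceFinMk, Pi.smul_apply, smul_eq_mul]
    rw [div_mul_eq_mul_div, eq_div_iff h0]
    refine mul_left_cancel₀ h0 ?_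
    linear_combination (-w 2) * hvv + v 2 * hvw + v 1 * h

/-- The form on the complement of `v` degenerates only along `v`: if `w` were null too, the squared
determinant of the projections would vanish. -/
theorem lorentz_self_ne_zero_of_null (hv : v ≠ 0) (hvv : lorentz v v = 0) (hvw : lorentz v w = 0)
    (hw : ¬ ∃ k : ℝ, w = k • v) : lorentz w w ≠ 0 := by
  intro h
  refine det_ne_zero_of_null hv hvv hvw hw ?_
  simp only [lorentz] at hvv hvw h
  have : (v 1 * w 2 - v 2 * w 1) ^ 2 = 0 := by
    linear_combination (w 1 ^ 2 + w 2 ^ 2) * hvv + v 0 ^ 2 * h -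
      (v 1 * w 1 + v 2 * w 2 + v 0 * w 0) * hvw
  simpa using this

end Algebra

/-! ### The direct part -/

section Direct

variable {I : Set ℝ} {γ : ℝ → Mink} {U : Set ℂ} {Γ : ℂ → Fin 3 → ℂ} {u : ℝ}

theorem IsNondegenerateNullCurve.lorentz_deriv_deriv (hγ : IsNondegenerateNullCurve I γ)
    (hu : u ∈ I) : lorentz (deriv γ u) (deriv (deriv γ) u) = 0 := by
  have h0 := hasDerivAt_pi.1 (hγ.analytic u hu).deriv.differentiableAt.hasDerivAt
  have h1 := (((h0 0).mul (h0 0)).neg.add ((h0 1).mul (h0 1))).add ((h0 2).mul (h0 2))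
  have h2 := h1.unique ((hasDerivAt_const u (0 : ℝ)).congr_of_eventuallyEq (by
    filter_upwards [hγ.isOpen.mem_nhds hu] with t ht using (hγ.null t ht).2))
  simp only [lorentz]
  linear_combination 2⁻¹ * h2

theorem phiHat_zero (h : IsHolomorphicExtension I γ U Γ) (hu : u ∈ I) :
    phiHat Γ (u, 0) = γ u := by
  funext j
  have := h.agree u hu j
  simp only [phiHat, phiHatC, le_refl, if_true, Real.sqrt_zero, ofReal_zero, mul_zero, add_zero,
    sub_zero, Pi.smul_apply, Pi.add_apply, this]
  simp only [smul_eq_mul, ← two_mul, inv_mul_cancel_left₀ (two_ne_zero (α := ℂ)), ofReal_re]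

theorem jac_phiHat_ne_zero (hγ : IsNondegenerateNullCurve I γ)
    (h : IsHolomorphicExtension I γ U Γ) (hu : u ∈ I) :
    jac (phiHat Γ) (u, 0) ≠ 0 := by
  have hγu := hγ.analytic u hu
  obtain ⟨h1, h2⟩ := even_null_at_zero (phiHat_analyticAt h hγ.isOpen hu hγu) hγu
    (eventually_phiHat_neg_sq h hγ.isOpen hu)
  have := det_ne_zero_of_null (hγ.null u hu).1 (hγ.null u hu).2 (hγ.lorentz_deriv_deriv hu)
    (hγ.nondegenerate u hu)
  rw [jac, h1, h1, h2, h2]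
  contrapose! this
  linear_combination (-2) * this

theorem lorentz_d₂_phiHat_ne_zero (hγ : IsNondegenerateNullCurve I γ)
    (h : IsHolomorphicExtension I γ U Γ) (hu : u ∈ I) :
    lorentz (d₂ (phiHat Γ) (u, 0)) (d₂ (phiHat Γ) (u, 0)) ≠ 0 := by
  have hγu := hγ.analytic u hu
  obtain ⟨-, h2⟩ := even_null_at_zero (phiHat_analyticAt h hγ.isOpen hu hγu) hγu
    (eventually_phiHat_neg_sq h hγ.isOpen hu)
  have := lorentz_self_ne_zero_of_null (hγ.null u hu).1 (hγ.null u hu).2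
    (hγ.lorentz_deriv_deriv hu) (hγ.nondegenerate u hu)
  simp only [lorentz] at this ⊢
  rw [h2, h2, h2]
  contrapose! this
  linear_combination 4 * this

/-- The regular part of the domain of `φ̂_γ`. -/
def goodSet (I : Set ℝ) (U : Set ℂ) (Γ : ℂ → Fin 3 → ℂ) : Set (ℝ × ℝ) :=
  {q | q ∈ phiHatDomain I U ∧ (∀ j, phiHatC Γ q j = (phiHat Γ q j : ℂ)) ∧
    AnalyticAt ℝ (phiHat Γ) q ∧ EvenNullData (phiHat Γ) q ∧ jac (phiHat Γ) q ≠ 0}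

theorem goodSet_mem_nhds (hγ : IsNondegenerateNullCurve I γ)
    (h : IsHolomorphicExtension I γ U Γ) (hu : u ∈ I) : goodSet I U Γ ∈ 𝓝 ((u, 0) : ℝ × ℝ) := by
  have hγu := hγ.analytic u hu
  have hφ := phiHat_analyticAt h hγ.isOpen hu hγu
  have hnull : ∀ᶠ t in 𝓝 u, lorentz (deriv γ t) (deriv γ t) = 0 := by
    filter_upwards [hγ.isOpen.mem_nhds hu] with t ht using (hγ.null t ht).2
  filter_upwards [h.eventually_mem_phiHatDomain hγ.isOpen hu,
    eventually_phiHatC_eq h hγ.isOpen hu hγu, hφ.eventually_analyticAt,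
    eventually_evenNullData hφ hγu hnull (eventually_phiHat_neg_sq h hγ.isOpen hu),
    (jac_analyticAt hφ).continuousAt.eventually_ne (jac_phiHat_ne_zero hγ h hu)]
    with q h1 h2 h3 h4 h5
  exact ⟨h1, h2, h3, h4, h5⟩

theorem exists_openPartialHomeomorph_proj (hγ : IsNondegenerateNullCurve I γ)
    (h : IsHolomorphicExtension I γ U Γ) (hu : u ∈ I) :
    ∃ e : OpenPartialHomeomorph (ℝ × ℝ) (ℝ × ℝ), (∀ q, e q = proj (phiHat Γ) q) ∧
      (u, 0) ∈ e.source ∧ ContDiffAt ℝ ω e.symm (proj (phiHat Γ) (u, 0)) := by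
  have hφ := phiHat_analyticAt h hγ.isOpen hu (hγ.analytic u hu)
  exact exists_openPartialHomeomorph (proj_analyticAt hφ).contDiffAt (by simp)
    (injective_fderiv_proj hφ.differentiableAt (jac_phiHat_ne_zero hγ h hu))

theorem isNondegenerateTypeChangeOfSurface_phiHat (hγ : IsNondegenerateNullCurve I γ)
    (h : IsHolomorphicExtension I γ U Γ) (hu : u ∈ I) :
    IsNondegenerateTypeChangeOfSurface (interior (goodSet I U Γ)) (phiHat Γ) (u, 0) := by
  set φ := phiHat Γ with hφdef
  set W := interior (goodSet I U Γ) with hW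
  have hWu : ((u, 0) : ℝ × ℝ) ∈ W := mem_interior_iff_mem_nhds.2 (goodSet_mem_nhds hγ h hu)
  have hgood : ∀ q ∈ W, q ∈ goodSet I U Γ := fun q hq => interior_subset hq
  obtain ⟨e, heφ, hsrc, hsymm⟩ := exists_openPartialHomeomorph_proj hγ h hu
  have htgt : proj φ (u, 0) ∈ e.target := by
    rw [← heφ]
    exact e.map_source hsrc
  have hback : e.symm (proj φ (u, 0)) = (u, 0) := by
    rw [← heφ]
    exact e.left_inv hsrc
  have hev : ∀ᶠ z in 𝓝 (proj φ (u, 0)), z ∈ e.target ∧ AnalyticAt ℝ e.symm z ∧ e.symm z ∈ W := by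
    have hc : ContinuousAt e.symm (proj φ (u, 0)) := hsymm.continuousAt
    filter_upwards [e.open_target.mem_nhds htgt, hsymm.analyticAt.eventually_analyticAt,
      hc (isOpen_interior.mem_nhds (by rw [hback]; exact hWu))] with z h1 h2 h3
    exact ⟨h1, h2, h3⟩
  obtain ⟨r, hr, hball⟩ := Metric.eventually_nhds_iff_ball.1 hev
  set Ω := Metric.ball (proj φ (u, 0)) r with hΩ
  have hΩt : Ω ⊆ e.target := fun z hz => (hball z hz).1
  -- The height read through the analytic local inverse of the projection; `Ω` is a ball, hence
  -- connected.
  set f : ℝ × ℝ → ℝ := fun z => φ (e.symm z) 0 with hf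
  have hfan : AnalyticOnNhd ℝ f Ω := fun z hz =>
    (analyticAt_pi_iff.1 (hgood _ (hball z hz).2.2).2.2.1 0).fun_comp (hball z hz).2.1
  have hfe : ∀ q ∈ e.source, φ q 0 = f (proj φ q) := by
    intro q hq
    simp only [hf]
    rw [← heφ q, e.left_inv hq]
  have hproj : ∀ z ∈ Ω, proj φ (e.symm z) = z := fun z hz => by
    rw [← heφ, e.right_inv (hΩt hz)]
  have hloc : ∀ q ∈ e.source, ∀ᶠ w in 𝓝 q, φ w 0 = f (proj φ w) := fun q hq => by
    filter_upwards [e.open_source.mem_nhds hq] with w hw using hfe w hw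
  refine ⟨e.symm '' Ω, ?_, ?_, ?_, Ω, f, ?_, hfan, ?_, ?_⟩
  · rintro _ ⟨z, hz, rfl⟩
    exact (hball z hz).2.2
  · exact e.symm.isOpen_image_of_subset_source Metric.isOpen_ball hΩt
  · exact ⟨_, Metric.mem_ball_self hr, hback⟩
  · refine ⟨Metric.isOpen_ball, Metric.isConnected_ball hr, hfan.contDiffOn
      Metric.isOpen_ball.uniqueDiffOn, fun z hz => ?_⟩
    obtain ⟨-, -, g3, g4, g5⟩ := hgood _ (hball z hz).2.2
    have := g4.graph_equation (f := f) g5 g3 (by rw [hproj z hz]; exact hfan z hz)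
      (hloc _ (e.map_target (hΩt hz)))
    rwa [hproj z hz] at this
  · ext p
    constructor
    · rintro ⟨_, ⟨z, hz, rfl⟩, rfl⟩
      refine ⟨z, hz, ?_⟩
      have h1 : φ (e.symm z) 1 = z.1 := congrArg Prod.fst (hproj z hz)
      have h2 : φ (e.symm z) 2 = z.2 := congrArg Prod.snd (hproj z hz)
      ext j
      fin_cases j <;> simp [hf, h1, h2]
    · rintro ⟨z, hz, rfl⟩
      refine ⟨e.symm z, ⟨z, hz, rfl⟩, ?_⟩
      have h1 : φ (e.symm z) 1 = z.1 := congrArg Prod.fst (hproj z hz)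
      have h2 : φ (e.symm z) 2 = z.2 := congrArg Prod.snd (hproj z hz)
      ext j
      fin_cases j <;> simp [hf, h1, h2]
  · refine isNondegenerateTypeChange_of_evenNullData ?_ (jac_phiHat_ne_zero hγ h hu)
      (lorentz_d₂_phiHat_ne_zero hγ h hu) (hgood _ hWu).2.2.1
      (hfan _ (Metric.mem_ball_self hr)) (hloc _ hsrc)
    filter_upwards [goodSet_mem_nhds hγ h hu] with q hq using hq.2.2.2.1

theorem exists_analyticZMCImmersion (hγ : IsNondegenerateNullCurve I γ)
    (h : IsHolomorphicExtension I γ U Γ) :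
    ∃ W : Set (ℝ × ℝ), IsOpen W ∧ (∀ u ∈ I, (u, (0 : ℝ)) ∈ W) ∧ W ⊆ phiHatDomain I U ∧
      (∀ q ∈ W, ∀ j, phiHatC Γ q j = (phiHat Γ q j : ℂ)) ∧
      IsAnalyticZMCImmersion W (phiHat Γ) ∧
      ∀ u ∈ I, phiHat Γ (u, 0) = γ u ∧
        IsNondegenerateTypeChangeOfSurface W (phiHat Γ) (u, 0) := by
  have hgood : ∀ q ∈ interior (goodSet I U Γ), q ∈ goodSet I U Γ := fun q hq => interior_subset hq
  refine ⟨interior (goodSet I U Γ), isOpen_interior,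
    fun u hu => mem_interior_iff_mem_nhds.2 (goodSet_mem_nhds hγ h hu),
    fun q hq => (hgood q hq).1, fun q hq => (hgood q hq).2.1,
    ⟨isOpen_interior, fun q hq => (hgood q hq).2.2.1, fun q hq => ?_, fun q hq => ?_⟩,
    fun u hu => ⟨phiHat_zero h hu, isNondegenerateTypeChangeOfSurface_phiHat hγ h hu⟩⟩
  · exact injective_fderiv_of_jac_ne_zero (hgood q hq).2.2.2.2
  · exact (hgood q hq).2.2.2.1.meanCurvatureNumerator_eq_zero

end Direct

/-! ### The gradient map at a point of type change -/

/-- The gradient of a function of two variables. -/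
noncomputable def grad (f : ℝ × ℝ → ℝ) (z : ℝ × ℝ) : ℝ × ℝ := (d₁ f z, d₂ f z)

section Smooth

variable {f : ℝ × ℝ → ℝ} {z : ℝ × ℝ}

theorem contDiffAt_d₁ {n m : WithTop ℕ∞} (hf : ContDiffAt ℝ n f z) (hmn : m + 1 ≤ n) :
    ContDiffAt ℝ m (d₁ f) z :=
  (hf.fderiv_right hmn).clm_apply contDiffAt_const

theorem contDiffAt_d₂ {n m : WithTop ℕ∞} (hf : ContDiffAt ℝ n f z) (hmn : m + 1 ≤ n) :
    ContDiffAt ℝ m (d₂ f) z :=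
  (hf.fderiv_right hmn).clm_apply contDiffAt_const

theorem differentiableAt_d₁ (hf : ContDiffAt ℝ 2 f z) : DifferentiableAt ℝ (d₁ f) z :=
  (contDiffAt_d₁ (m := 1) hf (by norm_num)).differentiableAt (by norm_num)

theorem differentiableAt_d₂ (hf : ContDiffAt ℝ 2 f z) : DifferentiableAt ℝ (d₂ f) z :=
  (contDiffAt_d₂ (m := 1) hf (by norm_num)).differentiableAt (by norm_num)

theorem fderiv_grad (hf : ContDiffAt ℝ 2 f z) (w : ℝ × ℝ) :
    fderiv ℝ (grad f) z w = (w.1 * d₁ (d₁ f) z + w.2 * d₂ (d₁ f) z,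
      w.1 * d₂ (d₁ f) z + w.2 * d₂ (d₂ f) z) := by
  have h : HasFDerivAt (grad f) _ z :=
    (differentiableAt_d₁ hf).hasFDerivAt.prodMk (differentiableAt_d₂ hf).hasFDerivAt
  rw [h.fderiv, ContinuousLinearMap.prod_apply, fderiv_eq_d₁_d₂, fderiv_eq_d₁_d₂,
    ← d₂_d₁_comm hf]
  rfl

theorem d₁_typeFun (hf : ContDiffAt ℝ 2 f z) :
    d₁ (typeFun f) z = -2 * (d₁ f z * d₁ (d₁ f) z + d₂ f z * d₂ (d₁ f) z) := by
  have h1 := (differentiableAt_d₁ hf)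
  have h2 := (differentiableAt_d₂ hf)
  have hB : DifferentiableAt ℝ (typeFun f) z :=
    ((differentiableAt_const _).sub (h1.pow 2)).sub (h2.pow 2)
  have e := (((hasDerivAt_const z.1 (1 : ℝ)).sub ((hasDerivAt_d₁ h1).pow 2)).sub
    ((hasDerivAt_d₁ h2).pow 2))
  have := (hasDerivAt_d₁ hB).unique e
  rw [this, d₂_d₁_comm hf]
  simp
  ring

theorem d₂_typeFun (hf : ContDiffAt ℝ 2 f z) :
    d₂ (typeFun f) z = -2 * (d₁ f z * d₂ (d₁ f) z + d₂ f z * d₂ (d₂ f) z) := by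
  have h1 := (differentiableAt_d₁ hf)
  have h2 := (differentiableAt_d₂ hf)
  have hB : DifferentiableAt ℝ (typeFun f) z :=
    ((differentiableAt_const _).sub (h1.pow 2)).sub (h2.pow 2)
  have e := (((hasDerivAt_const z.2 (1 : ℝ)).sub ((hasDerivAt_d₂ h1).pow 2)).sub
    ((hasDerivAt_d₂ h2).pow 2))
  have := (hasDerivAt_d₂ hB).unique e
  rw [this]
  simp
  ring

/-- At a non-degenerate point of type change the gradient is a local diffeomorphism. -/
theorem injective_fderiv_grad (hf : ContDiffAt ℝ 2 f z)
    (heq : (1 - d₂ f z ^ 2) * d₁ (d₁ f) z + 2 * d₁ f z * d₂ f z * d₂ (d₁ f) z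
      + (1 - d₁ f z ^ 2) * d₂ (d₂ f) z = 0)
    (hz : IsNondegenerateTypeChange f z) : Function.Injective (fderiv ℝ (grad f) z) := by
  obtain ⟨hB, hdB⟩ := hz
  rw [d₁_typeFun hf, d₂_typeFun hf] at hdB
  rw [typeFun] at hB
  rw [injective_iff_map_eq_zero]
  intro w hw
  rw [fderiv_grad hf] at hw
  have e1 := congrArg Prod.fst hw
  have e2 := congrArg Prod.snd hw
  simp only [Prod.fst_zero, Prod.snd_zero] at e1 e2
  generalize d₁ f z = a at *
  generalize d₂ f z = b at *
  generalize d₁ (d₁ f) z = r at *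
  generalize d₂ (d₁ f) z = s at *
  generalize d₂ (d₂ f) z = t at *
  -- Let `n = (a, b)` be the gradient, a unit vector here, and `H` the Hessian. The equation reduces
  -- to `n·Hn = 0`, while `Hn = -½∇B` is nonzero.
  have hn : a * (a * r + b * s) + b * (a * s + b * t) = 0 := by
    linear_combination heq - (r + t) * hB
  have hw' : w.1 * (a * r + b * s) + w.2 * (a * s + b * t) = 0 := by
    linear_combination a * e1 + b * e2
  have hne : a * r + b * s ≠ 0 ∨ a * s + b * t ≠ 0 := by
    by_contra! h
    exact hdB (by rw [h.1, h.2]; simp)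
  -- If `Hw = 0` then `w·Hn = 0`. So `w` and `n` are both orthogonal to the nonzero vector `Hn`, and
  -- are parallel; then `w = cn` with `cHn = 0` gives `c = 0`.
  have hpar : w.1 * b - w.2 * a = 0 := by
    rcases hne with h | h
    · refine (mul_eq_zero.1 (?_ : (a * r + b * s) * (w.1 * b - w.2 * a) = 0)).resolve_left h
      linear_combination b * hw' - w.2 * hn
    · refine (mul_eq_zero.1 (?_ : (a * s + b * t) * (w.1 * b - w.2 * a) = 0)).resolve_left h
      linear_combination w.1 * hn - a * hw'
  have hw1 : w.1 = a * (a * w.1 + b * w.2) := by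
    linear_combination w.1 * hB + b * hpar
  have hw2 : w.2 = b * (a * w.1 + b * w.2) := by
    linear_combination w.2 * hB - a * hpar
  have hc : a * w.1 + b * w.2 = 0 := by
    rcases hne with h | h
    · refine (mul_eq_zero.1 (?_ : (a * r + b * s) * (a * w.1 + b * w.2) = 0)).resolve_left h
      linear_combination e1 - r * hw1 - s * hw2
    · refine (mul_eq_zero.1 (?_ : (a * s + b * t) * (a * w.1 + b * w.2) = 0)).resolve_left h
      linear_combination e2 - s * hw1 - t * hw2
  ext
  · simpa [hc] using hw1
  · simpa [hc] using hw2

end Smooth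

/-! ### Polar coordinates in the gradient plane -/

/-- The radial profile of the conformal (`ε = 1`) or null (`ε = -1`) coordinates in the
gradient plane. -/
structure IsRadialProfile (ε : ℝ) (ρ k : ℝ → ℝ) (s : ℝ) : Prop where
  deriv_rho : HasDerivAt ρ (-k s * ρ s) s
  deriv_k : HasDerivAt k (ε - k s ^ 2) s
  rel : ε * k s ^ 2 = 1 - ρ s ^ 2
  rho_ne : ρ s ≠ 0
  k_ne : s ≠ 0 → k s ≠ 0
  smooth : ContDiffAt ℝ 2 ρ s

/-- The radial profile `1 / cosh`. -/
noncomputable def sechProfile (s : ℝ) : ℝ := (Real.cosh s)⁻¹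

/-- The radial profile `1 / cos`. -/
noncomputable def secProfile (s : ℝ) : ℝ := (Real.cos s)⁻¹

@[simp]
theorem sechProfile_zero : sechProfile 0 = 1 := by simp [sechProfile]

@[simp]
theorem secProfile_zero : secProfile 0 = 1 := by simp [secProfile]

theorem isRadialProfile_sech (s : ℝ) :
    IsRadialProfile 1 sechProfile (fun s => Real.sinh s / Real.cosh s) s := by
  change IsRadialProfile 1 (fun s => (Real.cosh s)⁻¹) _ s
  have hc := (Real.cosh_pos s).ne'
  refine ⟨?_, ?_, ?_, inv_ne_zero hc, fun h => ?_, ?_⟩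
  · refine ((Real.hasDerivAt_cosh s).fun_inv hc).congr_deriv ?_
    field_simp
  · refine ((Real.hasDerivAt_sinh s).fun_div (Real.hasDerivAt_cosh s) hc).congr_deriv ?_
    field_simp
  · field_simp
    rw [Real.cosh_sq]
    ring
  · simpa [hc] using h
  · exact Real.contDiff_cosh.contDiffAt.inv hc

theorem eventually_isRadialProfile_sec :
    ∀ᶠ s in 𝓝 (0 : ℝ),
      IsRadialProfile (-1) secProfile (fun s => -(Real.sin s / Real.cos s)) s := by
  change ∀ᶠ s in 𝓝 (0 : ℝ), IsRadialProfile (-1) (fun s => (Real.cos s)⁻¹) _ s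
  have h1 : ∀ᶠ s in 𝓝 (0 : ℝ), |s| < 1 := by
    have : ContinuousAt (fun s : ℝ => |s|) 0 := by fun_prop
    exact this.eventually_lt continuousAt_const (by simp)
  filter_upwards [h1] with s hs
  have hlt := abs_lt.1 hs
  have hpi := Real.pi_gt_three
  have hc : Real.cos s ≠ 0 :=
    (Real.cos_pos_of_mem_Ioo ⟨by linarith, by linarith⟩).ne'
  refine ⟨?_, ?_, ?_, inv_ne_zero hc, fun h => ?_, ?_⟩
  · refine ((Real.hasDerivAt_cos s).fun_inv hc).congr_deriv ?_
    field_simp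
  · refine ((Real.hasDerivAt_sin s).fun_div (Real.hasDerivAt_cos s) hc).fun_neg.congr_deriv ?_
    field_simp
    ring
  · field_simp
    rw [Real.sin_sq]
    ring
  · have : Real.sin s ≠ 0 := by
      intro h0
      rw [Real.sin_eq_zero_iff_of_lt_of_lt (by linarith) (by linarith)] at h0
      exact h h0
    exact neg_ne_zero.2 (div_ne_zero this hc)
  · exact Real.contDiff_cos.contDiffAt.inv hc

section System

variable {ε : ℝ} {ρ k : ℝ → ℝ} {x y : ℝ × ℝ → ℝ} {q : ℝ × ℝ}

/-- The first order system satisfied by the coordinates of the surface, regarded as functions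
of the polar angle and the radial parameter of the gradient. -/
structure FirstOrder (ε : ℝ) (k : ℝ → ℝ) (x y : ℝ × ℝ → ℝ) (q : ℝ × ℝ) : Prop where
  radial : -(d₂ x q * Real.sin q.1) + d₂ y q * Real.cos q.1 +
    k q.2 * (d₁ x q * Real.cos q.1 + d₁ y q * Real.sin q.1) = 0
  angular : -(d₁ x q * Real.sin q.1) + d₁ y q * Real.cos q.1 -
    ε * k q.2 * (d₂ x q * Real.cos q.1 + d₂ y q * Real.sin q.1) = 0

/-- Differentiating both equations in both variables and eliminating the mixed derivatives gives the
components of the vector of second order expressions along `(-sin θ, cos θ)` and `(cos θ, sin θ)`.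
-/
theorem secondOrder_of_firstOrder (hε : ε ^ 2 = 1) (hp : IsRadialProfile ε ρ k q.2)
    (hk : k q.2 ≠ 0) (hx : ContDiffAt ℝ 2 x q) (hy : ContDiffAt ℝ 2 y q)
    (h : ∀ᶠ w in 𝓝 q, FirstOrder ε k x y w) :
    d₂ (d₂ x) q + ε * d₁ (d₁ x) q = 0 ∧ d₂ (d₂ y) q + ε * d₁ (d₁ y) q = 0 := by
  have hx1 := differentiableAt_d₁ hx
  have hx2 := differentiableAt_d₂ hx
  have hy1 := differentiableAt_d₁ hy
  have hy2 := differentiableAt_d₂ hy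
  have cx : d₁ (d₂ x) q = d₂ (d₁ x) q := (d₂_d₁_comm hx).symm
  have cy : d₁ (d₂ y) q = d₂ (d₁ y) q := (d₂_d₁_comm hy).symm
  have hs := Real.hasDerivAt_sin q.1
  have hc := Real.hasDerivAt_cos q.1
  have F := h.self_of_nhds
  have r1 := ((((hasDerivAt_d₁ hx2).mul hs).neg.add ((hasDerivAt_d₁ hy2).mul hc)).add
    ((((hasDerivAt_d₁ hx1).mul hc).add ((hasDerivAt_d₁ hy1).mul hs)).const_mul (k q.2))).unique
    ((hasDerivAt_const q.1 (0 : ℝ)).congr_of_eventuallyEq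
      (by filter_upwards [eventually_comp_fst h] with t ht using ht.radial))
  have r2 := ((((hasDerivAt_d₂ hx2).mul_const (Real.sin q.1)).neg.add
      ((hasDerivAt_d₂ hy2).mul_const (Real.cos q.1))).add
    (hp.deriv_k.mul (((hasDerivAt_d₂ hx1).mul_const (Real.cos q.1)).add
      ((hasDerivAt_d₂ hy1).mul_const (Real.sin q.1))))).unique
    ((hasDerivAt_const q.2 (0 : ℝ)).congr_of_eventuallyEq
      (by filter_upwards [eventually_comp_snd h] with t ht using ht.radial))
  have a1 := ((((hasDerivAt_d₁ hx1).mul hs).neg.add ((hasDerivAt_d₁ hy1).mul hc)).sub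
    ((((hasDerivAt_d₁ hx2).mul hc).add ((hasDerivAt_d₁ hy2).mul hs)).const_mul
      (ε * k q.2))).unique
    ((hasDerivAt_const q.1 (0 : ℝ)).congr_of_eventuallyEq
      (by filter_upwards [eventually_comp_fst h] with t ht using ht.angular))
  have a2 := ((((hasDerivAt_d₂ hx1).mul_const (Real.sin q.1)).neg.add
      ((hasDerivAt_d₂ hy1).mul_const (Real.cos q.1))).sub
    ((hp.deriv_k.const_mul ε).mul (((hasDerivAt_d₂ hx2).mul_const (Real.cos q.1)).add
      ((hasDerivAt_d₂ hy2).mul_const (Real.sin q.1))))).unique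
    ((hasDerivAt_const q.2 (0 : ℝ)).congr_of_eventuallyEq
      (by filter_upwards [eventually_comp_snd h] with t ht using ht.angular))
  have f1 := F.radial
  have f2 := F.angular
  have hsc := Real.sin_sq_add_cos_sq q.1
  simp only [Pi.add_apply, cx, cy] at r1 r2 a1 a2
  generalize Real.sin q.1 = s at *
  generalize Real.cos q.1 = c at *
  generalize k q.2 = κ at *
  generalize d₁ x q = xθ at *
  generalize d₁ y q = yθ at *
  generalize d₂ x q = xτ at *
  generalize d₂ y q = yτ at *
  generalize d₁ (d₁ x) q = xθθ at *
  generalize d₁ (d₁ y) q = yθθ at *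
  generalize d₂ (d₁ x) q = xθτ at *
  generalize d₂ (d₁ y) q = yθτ at *
  generalize d₂ (d₂ x) q = xττ at *
  generalize d₂ (d₂ y) q = yττ at *
  have ln' : -(xττ + ε * xθθ) * s + (yττ + ε * yθθ) * c = 0 := by
    linear_combination r2 + ε * a1 + κ * f1 +
      κ * (xθτ * c + yθτ * s - xτ * s + yτ * c) * hε
  -- The radial component appears only with the factor `k`, hence the assumption `k ≠ 0`; `τ = 0` is
  -- recovered later by continuity.
  have ln0 : ε * κ * ((xττ + ε * xθθ) * c + (yττ + ε * yθθ) * s) = 0 := by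
    linear_combination r1 - a2 - κ * f2 +
      (κ * (xθθ * c + yθθ * s) - (xτ * c + yτ * s)) * hε
  have hε0 : ε ≠ 0 := by
    rintro rfl
    norm_num at hε
  have ln : (xττ + ε * xθθ) * c + (yττ + ε * yθθ) * s = 0 :=
    (mul_eq_zero.1 ln0).resolve_left (mul_ne_zero hε0 hk)
  constructor
  · linear_combination c * ln - s * ln' - (xττ + ε * xθθ) * hsc
  · linear_combination s * ln + c * ln' - (yττ + ε * yθθ) * hsc

/-- Differentiating `dT = ρ(cos θ dx + sin θ dy)` once more, the terms where the derivative falls on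
the coefficients cancel by the angular equation. -/
theorem secondOrder_height (hε : ε ^ 2 = 1) (hp : IsRadialProfile ε ρ k q.2) {T : ℝ × ℝ → ℝ}
    (hT : ContDiffAt ℝ 2 T q) (hx : ContDiffAt ℝ 2 x q) (hy : ContDiffAt ℝ 2 y q)
    (h : FirstOrder ε k x y q)
    (h1 : ∀ᶠ w in 𝓝 q, d₁ T w = d₁ x w * (ρ w.2 * Real.cos w.1) + d₁ y w * (ρ w.2 * Real.sin w.1))
    (h2 : ∀ᶠ w in 𝓝 q, d₂ T w = d₂ x w * (ρ w.2 * Real.cos w.1) + d₂ y w * (ρ w.2 * Real.sin w.1))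
    (hxx : d₂ (d₂ x) q + ε * d₁ (d₁ x) q = 0) (hyy : d₂ (d₂ y) q + ε * d₁ (d₁ y) q = 0) :
    d₂ (d₂ T) q + ε * d₁ (d₁ T) q = 0 := by
  have hs := (Real.hasDerivAt_sin q.1).const_mul (ρ q.2)
  have hc := (Real.hasDerivAt_cos q.1).const_mul (ρ q.2)
  have r1 := (hasDerivAt_d₁ (differentiableAt_d₁ hT)).unique
    ((((hasDerivAt_d₁ (differentiableAt_d₁ hx)).mul hc).add
      ((hasDerivAt_d₁ (differentiableAt_d₁ hy)).mul hs)).congr_of_eventuallyEq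
      (by filter_upwards [eventually_comp_fst h1] with t ht using ht))
  have r2 := (hasDerivAt_d₂ (differentiableAt_d₂ hT)).unique
    ((((hasDerivAt_d₂ (differentiableAt_d₂ hx)).mul
        (hp.deriv_rho.mul_const (Real.cos q.1))).add
      ((hasDerivAt_d₂ (differentiableAt_d₂ hy)).mul
        (hp.deriv_rho.mul_const (Real.sin q.1)))).congr_of_eventuallyEq
      (by filter_upwards [eventually_comp_snd h2] with t ht using ht))
  have f2 := h.angular
  rw [r1, r2]
  linear_combination (ρ q.2 * Real.cos q.1) * hxx + (ρ q.2 * Real.sin q.1) * hyy +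
    ε * ρ q.2 * f2 + k q.2 * ρ q.2 * (d₂ x q * Real.cos q.1 + d₂ y q * Real.sin q.1) * hε

/-- The zero mean curvature equation becomes the first order system in polar coordinates of the
gradient. -/
theorem firstOrder_of_grad {f : ℝ × ℝ → ℝ} (hp : IsRadialProfile ε ρ k q.2)
    (hk : k q.2 ≠ 0) (hx : DifferentiableAt ℝ x q) (hy : DifferentiableAt ℝ y q)
    (hf : ContDiffAt ℝ 2 f (x q, y q))
    (heq : (1 - d₂ f (x q, y q) ^ 2) * d₁ (d₁ f) (x q, y q) +
      2 * d₁ f (x q, y q) * d₂ f (x q, y q) * d₂ (d₁ f) (x q, y q)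
      + (1 - d₁ f (x q, y q) ^ 2) * d₂ (d₂ f) (x q, y q) = 0)
    (hg1 : ∀ᶠ w in 𝓝 q, d₁ f (x w, y w) = ρ w.2 * Real.cos w.1)
    (hg2 : ∀ᶠ w in 𝓝 q, d₂ f (x w, y w) = ρ w.2 * Real.sin w.1) :
    FirstOrder ε k x y q := by
  have hf1 := differentiableAt_d₁ hf
  have hf2 := differentiableAt_d₂ hf
  have hs := (Real.hasDerivAt_sin q.1).const_mul (ρ q.2)
  have hc := (Real.hasDerivAt_cos q.1).const_mul (ρ q.2)
  have e1 := (hasDerivAt_comp_pair (t := q.1) hf1 (hasDerivAt_d₁ hx) (hasDerivAt_d₁ hy)).unique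
    (hc.congr_of_eventuallyEq (by filter_upwards [eventually_comp_fst hg1] with t ht using ht))
  have e2 := (hasDerivAt_comp_pair (t := q.1) hf2 (hasDerivAt_d₁ hx) (hasDerivAt_d₁ hy)).unique
    (hs.congr_of_eventuallyEq (by filter_upwards [eventually_comp_fst hg2] with t ht using ht))
  have e3 := (hasDerivAt_comp_pair (t := q.2) hf1 (hasDerivAt_d₂ hx) (hasDerivAt_d₂ hy)).unique
    ((hp.deriv_rho.mul_const (Real.cos q.1)).congr_of_eventuallyEq
      (by filter_upwards [eventually_comp_snd hg1] with t ht using ht))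
  have e4 := (hasDerivAt_comp_pair (t := q.2) hf2 (hasDerivAt_d₂ hx) (hasDerivAt_d₂ hy)).unique
    ((hp.deriv_rho.mul_const (Real.sin q.1)).congr_of_eventuallyEq
      (by filter_upwards [eventually_comp_snd hg2] with t ht using ht))
  simp only [Prod.mk.eta, smul_eq_mul, ← d₂_d₁_comm hf] at e1 e2 e3 e4
  rw [hg1.self_of_nhds, hg2.self_of_nhds] at heq
  have hsc := Real.sin_sq_add_cos_sq q.1
  have hrel := hp.rel
  have hρ := hp.rho_ne
  constructor
  -- Symmetry of the Hessian alone: `z_θ·Hz_τ = z_τ·Hz_θ`, where `Hz_θ` and `Hz_τ` are the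
  -- derivatives of the polar gradient.
  · refine mul_left_cancel₀ hρ ?_
    linear_combination d₁ x q * e3 + d₁ y q * e4 - d₂ x q * e1 - d₂ y q * e2
  · generalize Real.sin q.1 = s at *
    generalize Real.cos q.1 = c at *
    generalize k q.2 = κ at *
    generalize ρ q.2 = R at *
    generalize d₁ x q = xθ at *
    generalize d₁ y q = yθ at *
    generalize d₂ x q = xτ at *
    generalize d₂ y q = yτ at *
    generalize d₁ (d₁ f) (x q, y q) = A at *
    generalize d₂ (d₁ f) (x q, y q) = B at *
    generalize d₂ (d₂ f) (x q, y q) = D at *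
    -- Pass to the frame `(cos θ, sin θ)`, `(-sin θ, cos θ)`: `h` is the Hessian, `a` is `z_τ` and
    -- `c` is `z_θ`. The equation for `f` becomes `h11 + εk² h22 = 0`.
    set h11 := A * c ^ 2 + 2 * B * s * c + D * s ^ 2 with h11d
    set h12 := (D - A) * s * c + B * (c ^ 2 - s ^ 2) with h12d
    set h22 := A * s ^ 2 - 2 * B * s * c + D * c ^ 2 with h22d
    set a1 := xτ * c + yτ * s with a1d
    set a2 := -(xτ * s) + yτ * c with a2d
    set c1 := xθ * c + yθ * s with c1d
    set c2 := -(xθ * s) + yθ * c with c2d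
    have g1 : h11 * a1 + h12 * a2 = -κ * R := by
      linear_combination (s ^ 2 + c ^ 2) * (c * e3 + s * e4) - κ * R * (s ^ 2 + c ^ 2 + 1) * hsc
    have g2 : h12 * a1 + h22 * a2 = 0 := by
      linear_combination (s ^ 2 + c ^ 2) * (c * e4 - s * e3)
    have g3 : h11 * c1 + h12 * c2 = 0 := by
      linear_combination (s ^ 2 + c ^ 2) * (c * e1 + s * e2)
    have g4 : h12 * c1 + h22 * c2 = R := by
      linear_combination (s ^ 2 + c ^ 2) * (c * e2 - s * e1) + R * (s ^ 2 + c ^ 2 + 1) * hsc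
    have g5 : h11 + ε * κ ^ 2 * h22 = 0 := by
      linear_combination heq + (A + D) * hsc + h22 * hrel
    have g6 : a2 = -κ * c1 := by
      refine mul_left_cancel₀ hρ ?_
      linear_combination c1 * g1 + c2 * g2 - a1 * g3 - a2 * g4
    -- The desired quantity is killed by both `h12` and `h22`, and these cannot both vanish because
    -- `h12 c1 + h22 c2 = ρ ≠ 0`.
    have m1 : h12 * (c2 - ε * κ * a1) = 0 := by
      linear_combination g3 - c1 * g5 - ε * κ * g2 + ε * κ * h22 * g6
    have m2 : κ * (h22 * (c2 - ε * κ * a1)) = 0 := by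
      linear_combination κ * g4 - h12 * g6 + g1 - a1 * g5
    have m3 : R * (c2 - ε * κ * a1) = 0 := by
      have m2' := (mul_eq_zero.1 m2).resolve_left hk
      linear_combination c1 * m1 + c2 * m2' - (c2 - ε * κ * a1) * g4
    exact (mul_eq_zero.1 m3).resolve_left hρ

end System

/-! ### Wave and Laplace equations with vanishing normal derivative -/

theorem eq_of_hasDerivAt_zero {ψ : ℝ → ℝ} {a r : ℝ} (h : ∀ s, |s - a| < r → HasDerivAt ψ 0 s) {s : ℝ}
    (hs : |s - a| < r) : ψ s = ψ a := by
  have hr : 0 < r := lt_of_le_of_lt (abs_nonneg _) hs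
  refine Metric.isOpen_ball.is_const_of_deriv_eq_zero (s := Metric.ball a r)
    (convex_ball _ _).isPreconnected (fun t ht => ?_) (fun t ht => ?_) ?_ ?_
  · exact (h t (by simpa [Real.dist_eq] using ht)).differentiableAt.differentiableWithinAt
  · exact (h t (by simpa [Real.dist_eq] using ht)).deriv
  · simpa [Real.dist_eq] using hs
  · simpa using hr

/-- `F_θ + F_τ` and `F_θ - F_τ` are constant along the characteristics `θ + τ` and `θ - τ` constant,
so their values are read off on `τ = 0`. Hence `F` minus the half sum has zero `τ`-derivative. The
size `r / 3` keeps the characteristics in the region where the equation holds. -/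
theorem dAlembert {F : ℝ × ℝ → ℝ} {u : ℝ}
    (hF : ∀ᶠ q in 𝓝 ((u, 0) : ℝ × ℝ), ContDiffAt ℝ 2 F q ∧ d₂ (d₂ F) q - d₁ (d₁ F) q = 0)
    (h0 : ∀ᶠ t in 𝓝 u, d₂ F (t, 0) = 0) :
    ∀ᶠ q in 𝓝 ((u, 0) : ℝ × ℝ), F q = 2⁻¹ * (F (q.1 + q.2, 0) + F (q.1 - q.2, 0)) := by
  obtain ⟨r₁, hr₁, hF⟩ := Metric.eventually_nhds_iff_ball.1 hF
  obtain ⟨r₂, hr₂, h0⟩ := Metric.eventually_nhds_iff_ball.1 h0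
  set r := min r₁ r₂ with hr
  have hr0 : 0 < r := lt_min hr₁ hr₂
  have hF' : ∀ a b : ℝ, |a - u| < r → |b| < r →
      ContDiffAt ℝ 2 F (a, b) ∧ d₂ (d₂ F) (a, b) - d₁ (d₁ F) (a, b) = 0 := by
    intro a b ha hb
    refine hF _ ?_
    simp [Prod.dist_eq, Real.dist_eq, lt_of_lt_of_le ha (min_le_left _ _),
      lt_of_lt_of_le hb (min_le_left _ _)]
  have h0' : ∀ a : ℝ, |a - u| < r → d₂ F (a, 0) = 0 := by
    intro a ha
    refine h0 _ ?_
    simp [Real.dist_eq, lt_of_lt_of_le ha (min_le_right _ _)]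
  have plus : ∀ a b : ℝ, |a - u| < r / 3 → |b| < r / 3 →
      d₁ F (a, b) + d₂ F (a, b) = d₁ F (a + b, 0) := by
    intro a b ha hb
    have hder : ∀ s, |s - 0| < r / 3 → HasDerivAt
        (fun s => d₁ F (a + b - s, s) + d₂ F (a + b - s, s)) 0 s := by
      intro s hs
      rw [abs_lt] at ha hb hs
      obtain ⟨hc, hw⟩ := hF' (a + b - s) s (by rw [abs_lt]; constructor <;> linarith)
        (by rw [abs_lt]; constructor <;> linarith)
      have hx : HasDerivAt (fun s : ℝ => a + b - s) (-1) s := by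
        simpa using (hasDerivAt_id s).const_sub (a + b)
      refine ((hasDerivAt_comp_pair (differentiableAt_d₁ hc) hx (hasDerivAt_id s)).add
        (hasDerivAt_comp_pair (differentiableAt_d₂ hc) hx (hasDerivAt_id s))).congr_deriv ?_
      simp only [smul_eq_mul, id, d₂_d₁_comm hc]
      linear_combination hw
    have := eq_of_hasDerivAt_zero hder (s := b) (by simpa using hb)
    simp only [add_sub_cancel_right, sub_zero] at this
    rw [this, h0' (a + b), add_zero]
    rw [abs_lt] at ha hb ⊢
    constructor <;> linarith
  have minus : ∀ a b : ℝ, |a - u| < r / 3 → |b| < r / 3 →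
      d₁ F (a, b) - d₂ F (a, b) = d₁ F (a - b, 0) := by
    intro a b ha hb
    have hder : ∀ s, |s - 0| < r / 3 → HasDerivAt
        (fun s => d₁ F (a - b + s, s) - d₂ F (a - b + s, s)) 0 s := by
      intro s hs
      rw [abs_lt] at ha hb hs
      obtain ⟨hc, hw⟩ := hF' (a - b + s) s (by rw [abs_lt]; constructor <;> linarith)
        (by rw [abs_lt]; constructor <;> linarith)
      have hx : HasDerivAt (fun s : ℝ => a - b + s) 1 s := by
        simpa using (hasDerivAt_id s).const_add (a - b)
      refine ((hasDerivAt_comp_pair (differentiableAt_d₁ hc) hx (hasDerivAt_id s)).sub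
        (hasDerivAt_comp_pair (differentiableAt_d₂ hc) hx (hasDerivAt_id s))).congr_deriv ?_
      simp only [smul_eq_mul, id, d₂_d₁_comm hc]
      linear_combination -hw
    have := eq_of_hasDerivAt_zero hder (s := b) (by simpa using hb)
    simp only [sub_add_cancel, add_zero] at this
    rw [this, h0' (a - b), sub_zero]
    rw [abs_lt] at ha hb ⊢
    constructor <;> linarith
  have c1 : ∀ᶠ q : ℝ × ℝ in 𝓝 (u, 0), |q.1 - u| < r / 3 := by
    have : ContinuousAt (fun q : ℝ × ℝ => |q.1 - u|) (u, 0) := by fun_prop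
    exact this.eventually_lt continuousAt_const (by simpa using hr0)
  have c2 : ∀ᶠ q : ℝ × ℝ in 𝓝 (u, 0), |q.2| < r / 3 := by
    have : ContinuousAt (fun q : ℝ × ℝ => |q.2|) (u, 0) := by fun_prop
    exact this.eventually_lt continuousAt_const (by simpa using hr0)
  filter_upwards [c1, c2] with q ha hb
  have hder : ∀ s, |s - 0| < r / 3 → HasDerivAt
      (fun s => F (q.1, s) - 2⁻¹ * (F (q.1 + s, 0) + F (q.1 - s, 0))) 0 s := by
    intro s hs
    have hs' : |s| < r / 3 := by simpa using hs
    have e1 := plus q.1 s ha hs'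
    have e2 := minus q.1 s ha hs'
    rw [abs_lt] at ha hb hs
    have d0 : DifferentiableAt ℝ F (q.1, s) :=
      (hF' q.1 s (by rw [abs_lt]; constructor <;> linarith)
        (by rw [abs_lt]; constructor <;> linarith)).1.differentiableAt (by norm_num)
    have dp : DifferentiableAt ℝ F (q.1 + s, 0) :=
      (hF' (q.1 + s) 0 (by rw [abs_lt]; constructor <;> linarith)
        (by simpa using hr0)).1.differentiableAt (by norm_num)
    have dm : DifferentiableAt ℝ F (q.1 - s, 0) :=
      (hF' (q.1 - s) 0 (by rw [abs_lt]; constructor <;> linarith)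
        (by simpa using hr0)).1.differentiableAt (by norm_num)
    have hp : HasDerivAt (fun s : ℝ => q.1 + s) 1 s := by
      simpa using (hasDerivAt_id s).const_add q.1
    have hm : HasDerivAt (fun s : ℝ => q.1 - s) (-1) s := by
      simpa using (hasDerivAt_id s).const_sub q.1
    refine ((hasDerivAt_d₂ d0).sub (((hasDerivAt_comp_pair dp hp
      (hasDerivAt_const s (0 : ℝ))).add (hasDerivAt_comp_pair dm hm
      (hasDerivAt_const s (0 : ℝ)))).const_mul 2⁻¹)).congr_deriv ?_
    simp only [smul_eq_mul]
    linear_combination 2⁻¹ * e1 - 2⁻¹ * e2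
  have := eq_of_hasDerivAt_zero hder (s := q.2) (by simpa using hb)
  simp only [add_zero, sub_zero] at this
  linear_combination this

theorem harmonicAt_of_d₁_d₂ {F : ℝ × ℝ → ℝ} {z : ℂ}
    (hF : ∀ᶠ q in 𝓝 ((z.re, z.im) : ℝ × ℝ), ContDiffAt ℝ 2 F q ∧
      d₂ (d₂ F) q + d₁ (d₁ F) q = 0) :
    InnerProductSpace.HarmonicAt (fun w : ℂ => F (w.re, w.im)) z := by
  have hL : Tendsto (fun w : ℂ => ((w.re, w.im) : ℝ × ℝ)) (𝓝 z) (𝓝 (z.re, z.im)) := by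
    have : ContinuousAt (fun w : ℂ => ((w.re, w.im) : ℝ × ℝ)) z := by fun_prop
    exact this
  have hcomp : ∀ {G : ℝ × ℝ → ℝ} {w : ℂ}, DifferentiableAt ℝ G (w.re, w.im) →
      HasFDerivAt (fun w : ℂ => G (w.re, w.im))
        ((fderiv ℝ G (w.re, w.im)).comp (reCLM.prod imCLM)) w := by
    intro G w hG
    exact hG.hasFDerivAt.comp w (reCLM.prod imCLM).hasFDerivAt
  have hcd : ∀ᶠ w in 𝓝 z, ContDiffAt ℝ 2 (fun w : ℂ => F (w.re, w.im)) w := by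
    filter_upwards [hL.eventually hF] with w hw
    exact hw.1.comp w (reCLM.prod imCLM).contDiff.contDiffAt
  refine ⟨hcd.self_of_nhds, ?_⟩
  have h1 : ∀ᶠ w in 𝓝 z, fderiv ℝ (fun w : ℂ => F (w.re, w.im)) w 1 = d₁ F (w.re, w.im) ∧
      fderiv ℝ (fun w : ℂ => F (w.re, w.im)) w I = d₂ F (w.re, w.im) := by
    filter_upwards [hL.eventually hF] with w hw
    rw [(hcomp (hw.1.differentiableAt (by norm_num))).fderiv]
    simp [d₁, d₂]
  filter_upwards [hcd, h1.eventually_nhds, hL.eventually hF] with w hw h1w hFw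
  rw [InnerProductSpace.laplacian_eq_iteratedFDeriv_complexPlane]
  simp only [iteratedFDeriv_two_apply, Fin.isValue, Matrix.cons_val_zero, Matrix.cons_val_one,
    Matrix.cons_val_fin_one, Pi.zero_apply]
  have hd : DifferentiableAt ℝ (fderiv ℝ (fun w : ℂ => F (w.re, w.im))) w :=
    (hw.fderiv_right (m := 1) (by norm_num)).differentiableAt (by norm_num)
  have h2 : ∀ v, fderiv ℝ (fderiv ℝ (fun w : ℂ => F (w.re, w.im))) w v v =
      fderiv ℝ (fun w' => fderiv ℝ (fun w : ℂ => F (w.re, w.im)) w' v) w v := by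
    intro v
    rw [fderiv_clm_apply hd (by fun_prop)]
    simp
  have e1 : (fun w' => fderiv ℝ (fun w : ℂ => F (w.re, w.im)) w' 1) =ᶠ[𝓝 w]
      fun w => d₁ F (w.re, w.im) := by
    filter_upwards [h1w] with w' hw' using hw'.1
  have e2 : (fun w' => fderiv ℝ (fun w : ℂ => F (w.re, w.im)) w' I) =ᶠ[𝓝 w]
      fun w => d₂ F (w.re, w.im) := by
    filter_upwards [h1w] with w' hw' using hw'.2
  rw [h2, h2, e1.fderiv_eq, e2.fderiv_eq, (hcomp (differentiableAt_d₁ hFw.1)).fderiv,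
    (hcomp (differentiableAt_d₂ hFw.1)).fderiv]
  have := hFw.2
  simp only [d₁, d₂] at this
  simp
  linarith

/-- A harmonic function with vanishing normal derivative on the real axis is the real part of a
holomorphic function that is real on the real axis. -/
theorem exists_holomorphic_of_harmonic {F : ℝ × ℝ → ℝ} {u : ℝ}
    (hF : ∀ᶠ q in 𝓝 ((u, 0) : ℝ × ℝ), ContDiffAt ℝ 2 F q ∧ d₂ (d₂ F) q + d₁ (d₁ F) q = 0)
    (h0 : ∀ᶠ t in 𝓝 u, d₂ F (t, 0) = 0) :
    ∃ C : ℂ → ℂ, AnalyticAt ℂ C u ∧ (∀ᶠ t : ℝ in 𝓝 u, C t = F (t, 0)) ∧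
      ∀ᶠ z : ℂ in 𝓝 (u : ℂ), (C z).re = F (z.re, z.im) := by
  have hL : Tendsto (fun w : ℂ => ((w.re, w.im) : ℝ × ℝ)) (𝓝 (u : ℂ)) (𝓝 (u, 0)) := by
    have : ContinuousAt (fun w : ℂ => ((w.re, w.im) : ℝ × ℝ)) (u : ℂ) := by fun_prop
    simpa [ContinuousAt] using this
  have hharm : ∀ᶠ z in 𝓝 (u : ℂ),
      InnerProductSpace.HarmonicAt (fun w : ℂ => F (w.re, w.im)) z := by
    filter_upwards [hL.eventually hF.eventually_nhds] with z hz using harmonicAt_of_d₁_d₂ hz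
  obtain ⟨R, hR, hball⟩ := Metric.eventually_nhds_iff_ball.1 hharm
  obtain ⟨C, hC, hre⟩ := InnerProductSpace.HarmonicOnNhd.exists_analyticOnNhd_ball_re_eq hball
  have hev : ∀ᶠ z : ℂ in 𝓝 (u : ℂ), (C z).re = F (z.re, z.im) := by
    filter_upwards [Metric.ball_mem_nhds _ hR] with z hz using hre hz
  have hCu : AnalyticAt ℂ C u := hC _ (Metric.mem_ball_self hR)
  have hofR : ContinuousAt (fun t : ℝ => (t : ℂ)) u := by fun_prop
  have hline : Tendsto (fun t : ℝ => ((t, 0) : ℝ × ℝ)) (𝓝 u) (𝓝 (u, 0)) := by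
    have : ContinuousAt (fun t : ℝ => ((t, 0) : ℝ × ℝ)) u := by fun_prop
    exact this
  -- Cauchy–Riemann: the derivative of `Im C` along the axis is minus the normal derivative of `Re
  -- C`. So `Im C` is constant on the axis and may be subtracted.
  have hder : ∀ᶠ t : ℝ in 𝓝 u, HasDerivAt (fun s : ℝ => (C s).im) 0 t := by
    filter_upwards [hofR.eventually hCu.eventually_analyticAt, hofR.eventually hev.eventually_nhds,
      h0, hline.eventually hF] with t h1 h2 h3 h4
    have hd := h1.differentiableAt.hasDerivAt
    have him : HasDerivAt (fun s : ℝ => (C s).im) (deriv C t).im t :=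
      imCLM.hasFDerivAt.comp_hasDerivAt t hd.comp_ofReal
    have hl : HasDerivAt (fun s : ℝ => (t : ℂ) + s * I) I 0 := by
      simpa using ((hasDerivAt_id (0 : ℝ)).ofReal_comp.mul_const I).const_add (t : ℂ)
    have hd' : HasDerivAt C (deriv C t) ((t : ℂ) + ((0 : ℝ) : ℂ) * I) := by simpa using hd
    have hv : HasDerivAt (fun s : ℝ => (C ((t : ℂ) + s * I)).re) (deriv C t * I).re 0 :=
      reCLM.hasFDerivAt.comp_hasDerivAt (0 : ℝ) (hd'.comp (0 : ℝ) hl)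
    have hF2 := hasDerivAt_d₂ (h4.1.differentiableAt (by norm_num))
    have hcl : Tendsto (fun s : ℝ => (t : ℂ) + s * I) (𝓝 0) (𝓝 (t : ℂ)) := by
      simpa [ContinuousAt] using hl.continuousAt
    have := hF2.unique (hv.congr_of_eventuallyEq (by
      filter_upwards [hcl.eventually h2] with s hs
      simpa using hs.symm))
    rw [h3] at this
    refine him.congr_deriv ?_
    simp at this
    linarith
  obtain ⟨δ, hδ, hder⟩ := Metric.eventually_nhds_iff_ball.1 hder
  refine ⟨fun z => C z - ((C u).im : ℂ) * I, hCu.sub analyticAt_const, ?_, ?_⟩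
  · filter_upwards [Metric.ball_mem_nhds u hδ, hofR.eventually hev] with t ht h2
    have him := eq_of_hasDerivAt_zero (ψ := fun s : ℝ => (C s).im) (a := u) (r := δ)
      (fun s hs => hder s (by simpa [Real.dist_eq] using hs))
      (s := t) (by simpa [Real.dist_eq] using ht)
    apply Complex.ext
    · simpa using h2
    · simpa [sub_eq_zero] using him
  · filter_upwards [hev] with z hz
    simpa using hz

/-! ### The graph in polar gradient coordinates -/

theorem eq_zero_of_eventually_ne {G : ℝ × ℝ → ℝ} {q : ℝ × ℝ} (hG : ContinuousAt G q)
    (h : ∀ᶠ w in 𝓝 q, w.2 ≠ 0 → G w = 0) : G q = 0 := by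
  by_cases hq : q.2 = 0
  · have hline : Tendsto (fun s : ℝ => ((q.1, s) : ℝ × ℝ)) (𝓝[≠] 0) (𝓝 q) := by
      have hc : ContinuousAt (fun s : ℝ => ((q.1, s) : ℝ × ℝ)) q.2 := by fun_prop
      rw [← hq]
      exact hc.tendsto.mono_left nhdsWithin_le_nhds
    refine tendsto_nhds_unique (hG.tendsto.comp hline) (tendsto_const_nhds.congr' ?_)
    filter_upwards [hline.eventually h, self_mem_nhdsWithin] with s hs hs0
    exact (hs hs0).symm
  · exact h.self_of_nhds hq

/-- Polar coordinates with radial profile `ρ`. -/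
noncomputable def polar (ρ : ℝ → ℝ) (q : ℝ × ℝ) : ℝ × ℝ :=
  (ρ q.2 * Real.cos q.1, ρ q.2 * Real.sin q.1)

/-- The graph of `f`, reparametrised by polar coordinates of the gradient through a local
inverse `Z` of the gradient map. -/
noncomputable def surf (f : ℝ × ℝ → ℝ) (Z : ℝ × ℝ → ℝ × ℝ) (ρ : ℝ → ℝ) (q : ℝ × ℝ) : Mink :=
  ![f (Z (polar ρ q)), (Z (polar ρ q)).1, (Z (polar ρ q)).2]

theorem polar_contDiffAt {ρ : ℝ → ℝ} {q : ℝ × ℝ} (h : ContDiffAt ℝ 2 ρ q.2) :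
    ContDiffAt ℝ 2 (polar ρ) q := by
  have h1 : ContDiffAt ℝ 2 (fun q : ℝ × ℝ => ρ q.2) q := h.comp q contDiffAt_snd
  have h2 : ContDiffAt ℝ 2 (fun q : ℝ × ℝ => Real.cos q.1) q :=
    Real.contDiff_cos.contDiffAt.comp q contDiffAt_fst
  have h3 : ContDiffAt ℝ 2 (fun q : ℝ × ℝ => Real.sin q.1) q :=
    Real.contDiff_sin.contDiffAt.comp q contDiffAt_fst
  exact (h1.mul h2).prodMk (h1.mul h3)

/-- Pointwise regularity of a gradient reparametrisation. -/
structure GradData (Ω : Set (ℝ × ℝ)) (f : ℝ × ℝ → ℝ) (Z : ℝ × ℝ → ℝ × ℝ) (ε : ℝ) (ρ k : ℝ → ℝ)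
    (q : ℝ × ℝ) : Prop where
  profile : IsRadialProfile ε ρ k q.2
  smooth : ContDiffAt ℝ 2 Z (polar ρ q)
  mem : Z (polar ρ q) ∈ Ω
  grad_eq : grad f (Z (polar ρ q)) = polar ρ q

section Surf

variable {Ω : Set (ℝ × ℝ)} {f : ℝ × ℝ → ℝ} {Z : ℝ × ℝ → ℝ × ℝ} {ε : ℝ} {ρ k : ℝ → ℝ}
  {q : ℝ × ℝ}

theorem IsZMCSolution.contDiffAt (hsol : IsZMCSolution Ω f) {z : ℝ × ℝ} (hz : z ∈ Ω) :
    ContDiffAt ℝ ∞ f z :=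
  hsol.smooth.contDiffAt (hsol.isOpen.mem_nhds hz)

theorem IsZMCSolution.contDiffAt_two (hsol : IsZMCSolution Ω f) {z : ℝ × ℝ} (hz : z ∈ Ω) :
    ContDiffAt ℝ 2 f z :=
  (hsol.contDiffAt hz).of_le (by norm_cast)

theorem GradData.contDiffAt_fst (h : GradData Ω f Z ε ρ k q) :
    ContDiffAt ℝ 2 (fun q => (Z (polar ρ q)).1) q :=
  (h.smooth.comp q (polar_contDiffAt h.profile.smooth)).fst

theorem GradData.contDiffAt_snd (h : GradData Ω f Z ε ρ k q) :
    ContDiffAt ℝ 2 (fun q => (Z (polar ρ q)).2) q :=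
  (h.smooth.comp q (polar_contDiffAt h.profile.smooth)).snd

theorem GradData.contDiffAt_height (hsol : IsZMCSolution Ω f) (h : GradData Ω f Z ε ρ k q) :
    ContDiffAt ℝ 2 (fun q => f (Z (polar ρ q))) q :=
  (hsol.contDiffAt_two h.mem).comp q (h.smooth.comp q (polar_contDiffAt h.profile.smooth))

/-- The derivation divides by `k`, which is nonzero only off `τ = 0`; on that line the equations
hold by continuity of the first derivatives. -/
theorem firstOrder_of_gradData (hsol : IsZMCSolution Ω f)
    (h : ∀ᶠ w in 𝓝 q, GradData Ω f Z ε ρ k w) :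
    FirstOrder ε k (fun q => (Z (polar ρ q)).1) (fun q => (Z (polar ρ q)).2) q := by
  set x := fun q => (Z (polar ρ q)).1 with hxd
  set y := fun q => (Z (polar ρ q)).2 with hyd
  have hne : ∀ᶠ w in 𝓝 q, w.2 ≠ 0 → FirstOrder ε k x y w := by
    filter_upwards [h.eventually_nhds] with w hw hw2
    have hw0 := hw.self_of_nhds
    refine firstOrder_of_grad hw0.profile (hw0.profile.k_ne hw2)
      (hw0.contDiffAt_fst.differentiableAt (by norm_num))
      (hw0.contDiffAt_snd.differentiableAt (by norm_num))
      (hsol.contDiffAt_two hw0.mem) (hsol.equation _ hw0.mem) ?_ ?_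
    · filter_upwards [hw] with v hv using congrArg Prod.fst hv.grad_eq
    · filter_upwards [hw] with v hv using congrArg Prod.snd hv.grad_eq
  have hq := h.self_of_nhds
  have cx1 := (differentiableAt_d₁ hq.contDiffAt_fst).continuousAt
  have cx2 := (differentiableAt_d₂ hq.contDiffAt_fst).continuousAt
  have cy1 := (differentiableAt_d₁ hq.contDiffAt_snd).continuousAt
  have cy2 := (differentiableAt_d₂ hq.contDiffAt_snd).continuousAt
  have ck : ContinuousAt (fun w : ℝ × ℝ => k w.2) q :=
    ContinuousAt.comp (f := Prod.snd) hq.profile.deriv_k.continuousAt continuousAt_snd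
  have cs : ContinuousAt (fun w : ℝ × ℝ => Real.sin w.1) q := by fun_prop
  have cc : ContinuousAt (fun w : ℝ × ℝ => Real.cos w.1) q := by fun_prop
  constructor
  · refine eq_zero_of_eventually_ne (G := fun q => -(d₂ x q * Real.sin q.1) +
      d₂ y q * Real.cos q.1 + k q.2 * (d₁ x q * Real.cos q.1 + d₁ y q * Real.sin q.1))
      (((cx2.mul cs).neg.add (cy2.mul cc)).add (ck.mul ((cx1.mul cc).add (cy1.mul cs)))) ?_
    filter_upwards [hne] with w hw hw2 using (hw hw2).radial
  · refine eq_zero_of_eventually_ne (G := fun q => -(d₁ x q * Real.sin q.1) +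
      d₁ y q * Real.cos q.1 - ε * k q.2 * (d₂ x q * Real.cos q.1 + d₂ y q * Real.sin q.1))
      (((cx1.mul cs).neg.add (cy1.mul cc)).sub
        ((continuousAt_const.mul ck).mul ((cx2.mul cc).add (cy2.mul cs)))) ?_
    filter_upwards [hne] with w hw hw2 using (hw hw2).angular

theorem continuousAt_d₁_d₁ {x : ℝ × ℝ → ℝ} (hx : ContDiffAt ℝ 2 x q) :
    ContinuousAt (d₁ (d₁ x)) q :=
  (contDiffAt_d₁ (m := 0) (contDiffAt_d₁ (m := 1) hx (by norm_num)) (by norm_num)).continuousAt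

theorem continuousAt_d₂_d₂ {x : ℝ × ℝ → ℝ} (hx : ContDiffAt ℝ 2 x q) :
    ContinuousAt (d₂ (d₂ x)) q :=
  (contDiffAt_d₂ (m := 0) (contDiffAt_d₂ (m := 1) hx (by norm_num)) (by norm_num)).continuousAt

theorem secondOrder_of_gradData (hε : ε ^ 2 = 1) (hsol : IsZMCSolution Ω f)
    (h : ∀ᶠ w in 𝓝 q, GradData Ω f Z ε ρ k w) :
    d₂ (d₂ fun q => (Z (polar ρ q)).1) q + ε * d₁ (d₁ fun q => (Z (polar ρ q)).1) q = 0 ∧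
    d₂ (d₂ fun q => (Z (polar ρ q)).2) q + ε * d₁ (d₁ fun q => (Z (polar ρ q)).2) q = 0 := by
  have hne : ∀ᶠ w in 𝓝 q, w.2 ≠ 0 →
      d₂ (d₂ fun q => (Z (polar ρ q)).1) w + ε * d₁ (d₁ fun q => (Z (polar ρ q)).1) w = 0 ∧
      d₂ (d₂ fun q => (Z (polar ρ q)).2) w + ε * d₁ (d₁ fun q => (Z (polar ρ q)).2) w = 0 := by
    filter_upwards [h.eventually_nhds] with w hw hw2
    have hw0 := hw.self_of_nhds
    refine secondOrder_of_firstOrder hε hw0.profile (hw0.profile.k_ne hw2) hw0.contDiffAt_fst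
      hw0.contDiffAt_snd ?_
    filter_upwards [hw.eventually_nhds] with v hv using firstOrder_of_gradData hsol hv
  have hq := h.self_of_nhds
  constructor
  · refine eq_zero_of_eventually_ne (G := fun q => d₂ (d₂ fun q => (Z (polar ρ q)).1) q +
      ε * d₁ (d₁ fun q => (Z (polar ρ q)).1) q) ((continuousAt_d₂_d₂ hq.contDiffAt_fst).add
        (continuousAt_const.mul (continuousAt_d₁_d₁ hq.contDiffAt_fst))) ?_
    filter_upwards [hne] with w hw hw2 using (hw hw2).1
  · refine eq_zero_of_eventually_ne (G := fun q => d₂ (d₂ fun q => (Z (polar ρ q)).2) q +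
      ε * d₁ (d₁ fun q => (Z (polar ρ q)).2) q) ((continuousAt_d₂_d₂ hq.contDiffAt_snd).add
        (continuousAt_const.mul (continuousAt_d₁_d₁ hq.contDiffAt_snd))) ?_
    filter_upwards [hne] with w hw hw2 using (hw hw2).2

theorem GradData.d₁_height (hsol : IsZMCSolution Ω f) (h : GradData Ω f Z ε ρ k q) :
    d₁ (fun q => f (Z (polar ρ q))) q =
      d₁ (fun q => (Z (polar ρ q)).1) q * (ρ q.2 * Real.cos q.1) +
      d₁ (fun q => (Z (polar ρ q)).2) q * (ρ q.2 * Real.sin q.1) := by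
  have e := hasDerivAt_comp_pair (F := f) (t := q.1) (x := fun t => (Z (polar ρ (t, q.2))).1)
    (y := fun t => (Z (polar ρ (t, q.2))).2)
    ((hsol.contDiffAt_two h.mem).differentiableAt (by norm_num))
    (hasDerivAt_d₁ (h.contDiffAt_fst.differentiableAt (by norm_num)))
    (hasDerivAt_d₁ (h.contDiffAt_snd.differentiableAt (by norm_num)))
  have e2 := (hasDerivAt_d₁ ((h.contDiffAt_height hsol).differentiableAt (by norm_num))).unique e
  have g1 : d₁ f (Z (polar ρ q)) = ρ q.2 * Real.cos q.1 := congrArg Prod.fst h.grad_eq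
  have g2 : d₂ f (Z (polar ρ q)) = ρ q.2 * Real.sin q.1 := congrArg Prod.snd h.grad_eq
  rw [e2]
  simp only [Prod.mk.eta, smul_eq_mul, g1, g2]

theorem GradData.d₂_height (hsol : IsZMCSolution Ω f) (h : GradData Ω f Z ε ρ k q) :
    d₂ (fun q => f (Z (polar ρ q))) q =
      d₂ (fun q => (Z (polar ρ q)).1) q * (ρ q.2 * Real.cos q.1) +
      d₂ (fun q => (Z (polar ρ q)).2) q * (ρ q.2 * Real.sin q.1) := by
  have e := hasDerivAt_comp_pair (F := f) (t := q.2) (x := fun t => (Z (polar ρ (q.1, t))).1)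
    (y := fun t => (Z (polar ρ (q.1, t))).2)
    ((hsol.contDiffAt_two h.mem).differentiableAt (by norm_num))
    (hasDerivAt_d₂ (h.contDiffAt_fst.differentiableAt (by norm_num)))
    (hasDerivAt_d₂ (h.contDiffAt_snd.differentiableAt (by norm_num)))
  have e2 := (hasDerivAt_d₂ ((h.contDiffAt_height hsol).differentiableAt (by norm_num))).unique e
  have g1 : d₁ f (Z (polar ρ q)) = ρ q.2 * Real.cos q.1 := congrArg Prod.fst h.grad_eq
  have g2 : d₂ f (Z (polar ρ q)) = ρ q.2 * Real.sin q.1 := congrArg Prod.snd h.grad_eq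
  rw [e2]
  simp only [Prod.mk.eta, smul_eq_mul, g1, g2]

theorem surf_equation (hε : ε ^ 2 = 1) (hsol : IsZMCSolution Ω f)
    (h : ∀ᶠ w in 𝓝 q, GradData Ω f Z ε ρ k w) (j : Fin 3) :
    ContDiffAt ℝ 2 (fun q => surf f Z ρ q j) q ∧
      d₂ (d₂ fun q => surf f Z ρ q j) q + ε * d₁ (d₁ fun q => surf f Z ρ q j) q = 0 := by
  have hq := h.self_of_nhds
  obtain ⟨hxx, hyy⟩ := secondOrder_of_gradData hε hsol h
  fin_cases j
  · refine ⟨hq.contDiffAt_height hsol, ?_⟩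
    refine secondOrder_height hε hq.profile (hq.contDiffAt_height hsol) hq.contDiffAt_fst
      hq.contDiffAt_snd (firstOrder_of_gradData hsol h) ?_ ?_ hxx hyy
    · filter_upwards [h] with w hw using hw.d₁_height hsol
    · filter_upwards [h] with w hw using hw.d₂_height hsol
  · exact ⟨hq.contDiffAt_fst, hxx⟩
  · exact ⟨hq.contDiffAt_snd, hyy⟩

/-- `ρ' = -kρ = 0`, so the polar coordinates are stationary in `τ`. -/
theorem d₂_surf_eq_zero (hsol : IsZMCSolution Ω f) (h : GradData Ω f Z ε ρ k q)
    (hk : k q.2 = 0) (j : Fin 3) : d₂ (fun q => surf f Z ρ q j) q = 0 := by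
  have hpol : HasDerivAt (fun s => polar ρ (q.1, s)) 0 q.2 := by
    have h1 := (h.profile.deriv_rho.mul_const (Real.cos q.1)).prodMk
      (h.profile.deriv_rho.mul_const (Real.sin q.1))
    exact h1.congr_deriv (by simp [hk])
  have hZ : HasDerivAt (fun s => Z (polar ρ (q.1, s))) 0 q.2 := by
    have h1 := (h.smooth.differentiableAt (by norm_num)).hasFDerivAt.comp_hasDerivAt
      (f := fun s => polar ρ (q.1, s)) q.2 hpol
    exact h1.congr_deriv (by simp)
  have h1 : d₂ (fun q => (Z (polar ρ q)).1) q = 0 :=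
    (hasDerivAt_d₂ (h.contDiffAt_fst.differentiableAt (by norm_num))).unique hZ.fst
  have h2 : d₂ (fun q => (Z (polar ρ q)).2) q = 0 :=
    (hasDerivAt_d₂ (h.contDiffAt_snd.differentiableAt (by norm_num))).unique hZ.snd
  fin_cases j
  · refine (h.d₂_height hsol).trans ?_
    rw [h1, h2]
    simp
  · exact h1
  · exact h2

/-- The velocity of the boundary curve is a non-zero multiple of `(1, cos θ, sin θ)`. -/
theorem d₁_surf_boundary (hsol : IsZMCSolution Ω f) (h : ∀ᶠ w in 𝓝 q, GradData Ω f Z ε ρ k w)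
    (hk : k q.2 = 0) (hρ : ρ q.2 = 1) :
    ∃ c : ℝ, c ≠ 0 ∧ (d₁ (fun q => surf f Z ρ q 0) q = c) ∧
      (d₁ (fun q => surf f Z ρ q 1) q = c * Real.cos q.1) ∧
      (d₁ (fun q => surf f Z ρ q 2) q = c * Real.sin q.1) := by
  have hq := h.self_of_nhds
  have hang := (firstOrder_of_gradData hsol h).angular
  have hT := hq.d₁_height hsol
  have hg1 : ∀ᶠ w in 𝓝 q, d₁ f (Z (polar ρ w)) = ρ w.2 * Real.cos w.1 := by
    filter_upwards [h] with v hv using congrArg Prod.fst hv.grad_eq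
  have hg2 : ∀ᶠ w in 𝓝 q, d₂ f (Z (polar ρ w)) = ρ w.2 * Real.sin w.1 := by
    filter_upwards [h] with v hv using congrArg Prod.snd hv.grad_eq
  have hf := hsol.contDiffAt_two hq.mem
  have hs := (Real.hasDerivAt_sin q.1).const_mul (ρ q.2)
  have hc := (Real.hasDerivAt_cos q.1).const_mul (ρ q.2)
  have hx := hasDerivAt_d₁ (hq.contDiffAt_fst.differentiableAt (by norm_num))
  have hy := hasDerivAt_d₁ (hq.contDiffAt_snd.differentiableAt (by norm_num))
  have e1 := (hasDerivAt_comp_pair (t := q.1) (x := fun t => (Z (polar ρ (t, q.2))).1)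
    (y := fun t => (Z (polar ρ (t, q.2))).2) (differentiableAt_d₁ hf) hx hy).unique
    (hc.congr_of_eventuallyEq (by filter_upwards [eventually_comp_fst hg1] with t ht using ht))
  have e2 := (hasDerivAt_comp_pair (t := q.1) (x := fun t => (Z (polar ρ (t, q.2))).1)
    (y := fun t => (Z (polar ρ (t, q.2))).2) (differentiableAt_d₂ hf) hx hy).unique
    (hs.congr_of_eventuallyEq (by filter_upwards [eventually_comp_fst hg2] with t ht using ht))
  have hsc := Real.sin_sq_add_cos_sq q.1
  rw [hk, mul_zero, zero_mul, sub_zero] at hang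
  rw [hρ, one_mul, one_mul] at hT
  change ∃ c : ℝ, c ≠ 0 ∧ (d₁ (fun q => f (Z (polar ρ q))) q = c) ∧
      (d₁ (fun q => (Z (polar ρ q)).1) q = c * Real.cos q.1) ∧
      (d₁ (fun q => (Z (polar ρ q)).2) q = c * Real.sin q.1)
  rw [hρ] at e1 e2
  simp only [smul_eq_mul, one_mul] at e1 e2
  generalize d₁ (fun q => (Z (polar ρ q)).1) q = xθ at *
  generalize d₁ (fun q => (Z (polar ρ q)).2) q = yθ at *
  have h1 : xθ = (xθ * Real.cos q.1 + yθ * Real.sin q.1) * Real.cos q.1 := by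
    linear_combination (-xθ) * hsc - Real.sin q.1 * hang
  have h2 : yθ = (xθ * Real.cos q.1 + yθ * Real.sin q.1) * Real.sin q.1 := by
    linear_combination (-yθ) * hsc + Real.cos q.1 * hang
  -- If `c` were zero, `z_θ` would vanish, but the Hessian sends it to the unit vector `(-sin θ, cos
  -- θ)`.
  refine ⟨xθ * Real.cos q.1 + yθ * Real.sin q.1, fun h0 => ?_, hT, h1, h2⟩
  rw [h0, zero_mul] at h1 h2
  rw [h1, h2, zero_mul, zero_mul, add_zero] at e1 e2
  have e3 : Real.sin q.1 = 0 := by linarith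
  rw [e3, ← e2] at hsc
  norm_num at hsc

end Surf

/-- The curve of type change, parametrised by the angle of the gradient. -/
noncomputable def boundaryCurve (f : ℝ × ℝ → ℝ) (Z : ℝ × ℝ → ℝ × ℝ) (t : ℝ) : Mink :=
  ![f (Z (Real.cos t, Real.sin t)), (Z (Real.cos t, Real.sin t)).1,
    (Z (Real.cos t, Real.sin t)).2]

theorem surf_zero (f : ℝ × ℝ → ℝ) (Z : ℝ × ℝ → ℝ × ℝ) {ρ : ℝ → ℝ} (hρ : ρ 0 = 1) (t : ℝ) :
    surf f Z ρ (t, 0) = boundaryCurve f Z t := by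
  simp [surf, boundaryCurve, polar, hρ]

/-! ### The converse -/

section Converse

variable {Ω : Set (ℝ × ℝ)} {f : ℝ × ℝ → ℝ} {Z : ℝ × ℝ → ℝ × ℝ} {θ : ℝ}

theorem eventually_gradData {ε : ℝ} {ρ k : ℝ → ℝ}
    (hZ : ∀ᶠ w in 𝓝 ((Real.cos θ, Real.sin θ) : ℝ × ℝ),
      ContDiffAt ℝ 2 Z w ∧ Z w ∈ Ω ∧ grad f (Z w) = w)
    (hp : ∀ᶠ s in 𝓝 (0 : ℝ), IsRadialProfile ε ρ k s) (hρ : ρ 0 = 1) :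
    ∀ᶠ q in 𝓝 ((θ, 0) : ℝ × ℝ), GradData Ω f Z ε ρ k q := by
  have h1 : Tendsto (polar ρ) (𝓝 (θ, 0)) (𝓝 (Real.cos θ, Real.sin θ)) := by
    have hc : ContinuousAt (polar ρ) (θ, 0) :=
      (polar_contDiffAt (q := (θ, 0)) hp.self_of_nhds.smooth).continuousAt
    simpa [ContinuousAt, polar, hρ] using hc
  have h2 : Tendsto (Prod.snd : ℝ × ℝ → ℝ) (𝓝 (θ, 0)) (𝓝 0) := continuous_snd.continuousAt
  filter_upwards [h1.eventually hZ, h2.eventually hp] with q hq hq2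
  exact ⟨hq2, hq.1, hq.2.1, hq.2.2⟩

theorem eventually_line {P : ℝ × ℝ → Prop} (h : ∀ᶠ q in 𝓝 ((θ, 0) : ℝ × ℝ), P q) :
    ∀ᶠ t in 𝓝 θ, P (t, 0) :=
  eventually_comp_fst (q := (θ, 0)) h

/-- This is the source of analyticity: the elliptic side alone extends the curve holomorphically,
and the real part of the extension gives the surface back on that side. -/
theorem exists_holomorphic_boundaryCurve (hsol : IsZMCSolution Ω f)
    (hZ : ∀ᶠ w in 𝓝 ((Real.cos θ, Real.sin θ) : ℝ × ℝ),
      ContDiffAt ℝ 2 Z w ∧ Z w ∈ Ω ∧ grad f (Z w) = w) (j : Fin 3) :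
    ∃ C : ℂ → ℂ, AnalyticAt ℂ C θ ∧ (∀ᶠ t : ℝ in 𝓝 θ, C t = boundaryCurve f Z t j) ∧
      ∀ᶠ z : ℂ in 𝓝 (θ : ℂ), (C z).re = surf f Z sechProfile (z.re, z.im) j := by
  have hg := eventually_gradData hZ (Eventually.of_forall isRadialProfile_sech) (by simp)
  obtain ⟨C, hC, h1, h2⟩ := exists_holomorphic_of_harmonic
    (F := fun q => surf f Z sechProfile q j) (u := θ) (by
      filter_upwards [hg.eventually_nhds] with q hq
      simpa using surf_equation (by norm_num) hsol hq j) (by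
      filter_upwards [eventually_line hg] with t ht
      exact d₂_surf_eq_zero hsol ht (by simp) j)
  refine ⟨C, hC, ?_, h2⟩
  filter_upwards [h1] with t ht
  rw [ht, surf_zero f Z sechProfile_zero]

theorem surf_sec_eq (hsol : IsZMCSolution Ω f)
    (hZ : ∀ᶠ w in 𝓝 ((Real.cos θ, Real.sin θ) : ℝ × ℝ),
      ContDiffAt ℝ 2 Z w ∧ Z w ∈ Ω ∧ grad f (Z w) = w) (j : Fin 3) :
    ∀ᶠ q in 𝓝 ((θ, 0) : ℝ × ℝ), surf f Z secProfile q j =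
      2⁻¹ * (boundaryCurve f Z (q.1 + q.2) j + boundaryCurve f Z (q.1 - q.2) j) := by
  have hg := eventually_gradData hZ eventually_isRadialProfile_sec (by simp)
  have h := dAlembert (F := fun q => surf f Z secProfile q j) (u := θ) (by
      filter_upwards [hg.eventually_nhds] with q hq
      obtain ⟨h1, h2⟩ := surf_equation (by norm_num) hsol hq j
      refine ⟨h1, ?_⟩
      change d₂ (d₂ fun q => surf f Z secProfile q j) q +
        -1 * d₁ (d₁ fun q => surf f Z secProfile q j) q = 0 at h2
      linear_combination h2) (by
      filter_upwards [eventually_line hg] with t ht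
      exact d₂_surf_eq_zero hsol ht (by simp) j)
  simpa only [surf_zero f Z secProfile_zero] using h

theorem analyticAt_boundaryCurve (hsol : IsZMCSolution Ω f)
    (hZ : ∀ᶠ w in 𝓝 ((Real.cos θ, Real.sin θ) : ℝ × ℝ),
      ContDiffAt ℝ 2 Z w ∧ Z w ∈ Ω ∧ grad f (Z w) = w) :
    AnalyticAt ℝ (boundaryCurve f Z) θ := by
  refine analyticAt_pi_iff.2 fun j => ?_
  obtain ⟨C, hC, h1, -⟩ := exists_holomorphic_boundaryCurve hsol hZ j
  have h2 : AnalyticAt ℝ (fun t : ℝ => (C t).re) θ :=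
    (reCLM.analyticAt _).fun_comp ((hC.restrictScalars (𝕜 := ℝ)).fun_comp (ofRealCLM.analyticAt θ))
  refine h2.congr ?_
  filter_upwards [h1] with t ht
  simp [ht]

theorem eventually_deriv_boundaryCurve (hsol : IsZMCSolution Ω f)
    (hZ : ∀ᶠ w in 𝓝 ((Real.cos θ, Real.sin θ) : ℝ × ℝ),
      ContDiffAt ℝ 2 Z w ∧ Z w ∈ Ω ∧ grad f (Z w) = w) :
    ∃ c : ℝ → ℝ, ∀ᶠ t in 𝓝 θ, c t ≠ 0 ∧ DifferentiableAt ℝ c t ∧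
      deriv (boundaryCurve f Z) t = ![c t, c t * Real.cos t, c t * Real.sin t] := by
  have hg := eventually_gradData hZ (Eventually.of_forall isRadialProfile_sech) (by simp)
  refine ⟨fun t => d₁ (fun q => surf f Z sechProfile q 0) (t, 0), ?_⟩
  filter_upwards [eventually_line hg.eventually_nhds] with t ht
  have hsm : ∀ j, ContDiffAt ℝ 2 (fun q => surf f Z sechProfile q j) (t, 0) := fun j =>
    (surf_equation (by norm_num) hsol ht j).1
  obtain ⟨c, hc0, hc, h1, h2⟩ := d₁_surf_boundary hsol ht (by simp) (by simp)
  change d₁ (fun q => surf f Z sechProfile q 0) (t, 0) = c at hc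
  change d₁ (fun q => surf f Z sechProfile q 1) (t, 0) = c * Real.cos t at h1
  change d₁ (fun q => surf f Z sechProfile q 2) (t, 0) = c * Real.sin t at h2
  refine ⟨by rw [hc]; exact hc0, ?_, ?_⟩
  · exact (hasDerivAt_d₁ (differentiableAt_d₁ (hsm 0))).differentiableAt
  · refine HasDerivAt.deriv (hasDerivAt_pi.2 fun j => ?_)
    have h3 : HasDerivAt (fun s => boundaryCurve f Z s j)
        (d₁ (fun q => surf f Z sechProfile q j) (t, 0)) t := by
      have := hasDerivAt_d₁ ((hsm j).differentiableAt (by norm_num))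
      simpa only [surf_zero f Z sechProfile_zero] using this
    refine h3.congr_deriv ?_
    fin_cases j
    · simp
    · simpa [hc] using h1
    · simpa [hc] using h2

theorem exists_isNondegenerateNullCurve (hsol : IsZMCSolution Ω f)
    (hZ : ∀ᶠ w in 𝓝 ((Real.cos θ, Real.sin θ) : ℝ × ℝ),
      ContDiffAt ℝ 2 Z w ∧ Z w ∈ Ω ∧ grad f (Z w) = w) :
    ∃ I : Set ℝ, θ ∈ I ∧ IsNondegenerateNullCurve I (boundaryCurve f Z) := by
  obtain ⟨c, hc⟩ := eventually_deriv_boundaryCurve hsol hZ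
  obtain ⟨δ, hδ, hball⟩ := Metric.eventually_nhds_iff_ball.1
    (hc.eventually_nhds.and (analyticAt_boundaryCurve hsol hZ).eventually_analyticAt)
  refine ⟨Metric.ball θ δ, Metric.mem_ball_self hδ, Metric.isOpen_ball,
    (convex_ball θ δ).ordConnected, ⟨θ, Metric.mem_ball_self hδ⟩, fun t ht => (hball t ht).2,
    fun t ht => ?_, fun t ht => ?_⟩
  · obtain ⟨h0, -, h1⟩ := (hball t ht).1.self_of_nhds
    rw [h1]
    refine ⟨fun h => h0 (by simpa using congrFun h 0), ?_⟩
    simp only [lorentz, Matrix.cons_val_zero, Matrix.cons_val_one, Matrix.cons_val]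
    linear_combination c t ^ 2 * Real.sin_sq_add_cos_sq t
  · rintro ⟨κ, hκ⟩
    obtain ⟨h0, hd, h1⟩ := (hball t ht).1.self_of_nhds
    have hder := hd.hasDerivAt
    have h2 : HasDerivAt (fun t => ![c t, c t * Real.cos t, c t * Real.sin t])
        ![deriv c t, deriv c t * Real.cos t + c t * (-Real.sin t),
          deriv c t * Real.sin t + c t * Real.cos t] t := by
      refine hasDerivAt_pi.2 fun j => ?_
      fin_cases j
      · exact hder
      · exact hder.mul (Real.hasDerivAt_cos t)
      · exact hder.mul (Real.hasDerivAt_sin t)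
    have h3 : deriv (deriv (boundaryCurve f Z)) t = _ := (h2.congr_of_eventuallyEq (by
      filter_upwards [(hball t ht).1] with s hs using hs.2.2)).deriv
    rw [h3, h1] at hκ
    have k0 := congrFun hκ 0
    have k1 := congrFun hκ 1
    have k2 := congrFun hκ 2
    simp only [Matrix.cons_val_zero, Matrix.cons_val_one, Matrix.cons_val, Pi.smul_apply,
      smul_eq_mul] at k0 k1 k2
    -- Removing the multiple of `γ'` leaves `c(0, -sin t, cos t) = 0`, which forces `c = 0`.
    apply h0
    linear_combination (-Real.sin t) * (k1 - Real.cos t * k0) +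
      Real.cos t * (k2 - Real.sin t * k0) - c t * Real.sin_sq_add_cos_sq t

theorem surf_sech_neg (f : ℝ × ℝ → ℝ) (Z : ℝ × ℝ → ℝ × ℝ) (u s : ℝ) :
    surf f Z sechProfile (u, -s) = surf f Z sechProfile (u, s) := by
  simp [surf, polar, sechProfile]

/-- Near the curve of type change, `φ̂_γ` parametrises the graph of `f`. -/
theorem eventually_phiHat_mem_graph (hsol : IsZMCSolution Ω f)
    (hZ : ∀ᶠ w in 𝓝 ((Real.cos θ, Real.sin θ) : ℝ × ℝ),
      ContDiffAt ℝ 2 Z w ∧ Z w ∈ Ω ∧ grad f (Z w) = w) {I : Set ℝ} (hI : IsOpen I) (hθ : θ ∈ I)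
    {U : Set ℂ} {Γ : ℂ → Fin 3 → ℂ} (h : IsHolomorphicExtension I (boundaryCurve f Z) U Γ) :
    ∀ᶠ q in 𝓝 ((θ, 0) : ℝ × ℝ), ∃ z ∈ Ω, phiHat Γ q = ![f z, z.1, z.2] := by
  have hre : ∀ᶠ z in 𝓝 (θ : ℂ), ∀ j, (Γ z j).re = surf f Z sechProfile (z.re, z.im) j := by
    refine eventually_all.2 fun j => ?_
    obtain ⟨C, hC, h1, h2⟩ := exists_holomorphic_boundaryCurve hsol hZ j
    have hE : C =ᶠ[𝓝 (θ : ℂ)] fun z => Γ z j := by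
      refine eventuallyEq_of_eventually_ofReal hC (h.analyticAt hθ j) ?_
      filter_upwards [h1, hI.mem_nhds hθ] with t ht htI
      rw [ht, h.agree t htI j]
    filter_upwards [hE, h2] with z hz hz2
    rw [← hz, hz2]
  have hg1 := eventually_gradData hZ (Eventually.of_forall isRadialProfile_sech) (by simp)
  have hg2 := eventually_gradData hZ eventually_isRadialProfile_sec (by simp)
  have hsec : ∀ᶠ q in 𝓝 ((θ, 0) : ℝ × ℝ), ∀ j,
      phiHat Γ (q.1, -q.2 ^ 2) j = surf f Z secProfile q j := by
    refine eventually_all.2 fun j => ?_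
    filter_upwards [surf_sec_eq hsol hZ j, eventually_phiHat_neg_sq h hI hθ j] with q h1 h2
    rw [h1, h2]
  obtain ⟨t1, t2, -, -⟩ := tendsto_phiHat_args θ
  have tp : Tendsto (fun q : ℝ × ℝ => (q.1, √q.2)) (𝓝 (θ, 0)) (𝓝 (θ, 0)) := by
    have : ContinuousAt (fun q : ℝ × ℝ => (q.1, √q.2)) (θ, 0) := by fun_prop
    simpa [ContinuousAt] using this
  have tm : Tendsto (fun q : ℝ × ℝ => (q.1, √(-q.2))) (𝓝 (θ, 0)) (𝓝 (θ, 0)) := by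
    have : ContinuousAt (fun q : ℝ × ℝ => (q.1, √(-q.2))) (θ, 0) := by fun_prop
    simpa [ContinuousAt] using this
  filter_upwards [t1.eventually hre, t2.eventually hre, tp.eventually hg1, tm.eventually hg2,
    tm.eventually hsec] with q h1 h2 h3 h4 h5
  -- For `v ≥ 0` the points `u ± i√v` give the same point of the surface, `1/cosh` being even; for
  -- `v < 0` the half sum is used with `τ = √(-v)`.
  by_cases hq : 0 ≤ q.2
  · refine ⟨_, h3.mem, ?_⟩
    change phiHat Γ q = surf f Z sechProfile (q.1, √q.2)
    funext j
    have e1 := h1 j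
    have e2 := h2 j
    simp only [add_re, ofReal_re, mul_re, I_re, I_im, ofReal_im, add_im, mul_im, sub_re, sub_im,
      zero_mul, one_mul, mul_zero, sub_zero, add_zero, zero_add, zero_sub] at e1 e2
    rw [surf_sech_neg] at e2
    simp only [phiHat, phiHatC, hq, if_true, Pi.smul_apply, Pi.add_apply, smul_eq_mul]
    have : ∀ z : ℂ, (2⁻¹ * z).re = 2⁻¹ * z.re := fun z => by
      rw [show (2⁻¹ : ℂ) = ((2⁻¹ : ℝ) : ℂ) by simp, re_ofReal_mul]
    rw [this, add_re, e1, e2]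
    ring
  · refine ⟨_, h4.mem, ?_⟩
    change phiHat Γ q = surf f Z secProfile (q.1, √(-q.2))
    funext j
    have e := h5 j
    simp only [Real.sq_sqrt (show (0 : ℝ) ≤ -q.2 by linarith), neg_neg] at e
    exact e

theorem exists_nullCurve_of_typeChange {p : ℝ × ℝ} (hsol : IsZMCSolution Ω f) (hp : p ∈ Ω)
    (ht : IsNondegenerateTypeChange f p) :
    ∃ (I : Set ℝ) (γ : ℝ → Mink) (u₀ : ℝ),
      IsNondegenerateNullCurve I γ ∧ u₀ ∈ I ∧ γ u₀ = ![f p, p.1, p.2] ∧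
      (∃ (U : Set ℂ) (Γ : ℂ → Fin 3 → ℂ), IsHolomorphicExtension I γ U Γ) ∧
      ∀ (U : Set ℂ) (Γ : ℂ → Fin 3 → ℂ), IsHolomorphicExtension I γ U Γ →
        ∃ (V Ω' : Set (ℝ × ℝ)), IsOpen V ∧ (u₀, (0 : ℝ)) ∈ V ∧
          V ⊆ phiHatDomain I U ∧ IsOpen Ω' ∧ p ∈ Ω' ∧ Ω' ⊆ Ω ∧
          (∀ q ∈ V, ∀ j, phiHatC Γ q j = (phiHat Γ q j : ℂ)) ∧
          phiHat Γ '' V = graphOver f Ω' := by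
  obtain ⟨θ, hθ⟩ : ∃ θ : ℝ, grad f p = (Real.cos θ, Real.sin θ) := by
    have hn : ‖(⟨d₁ f p, d₂ f p⟩ : ℂ)‖ = 1 := by
      have h1 := ht.1
      rw [typeFun] at h1
      rw [← sq_eq_sq₀ (norm_nonneg _) zero_le_one, Complex.sq_norm, normSq_mk]
      linarith
    refine ⟨arg ⟨d₁ f p, d₂ f p⟩, ?_⟩
    have h1 := norm_mul_cos_arg (⟨d₁ f p, d₂ f p⟩ : ℂ)
    have h2 := norm_mul_sin_arg (⟨d₁ f p, d₂ f p⟩ : ℂ)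
    rw [hn, one_mul] at h1 h2
    rw [h1, h2]
    rfl
  have hf := hsol.contDiffAt hp
  have hgrad : ContDiffAt ℝ 2 (grad f) p :=
    (contDiffAt_d₁ hf (by norm_cast)).prodMk (contDiffAt_d₂ hf (by norm_cast))
  obtain ⟨e, he, hsrc, hsymm⟩ := exists_openPartialHomeomorph hgrad (by norm_num)
    (injective_fderiv_grad (hsol.contDiffAt_two hp) (hsol.equation p hp) ht)
  have htgt : grad f p ∈ e.target := by
    rw [← he]
    exact e.map_source hsrc
  have hback : e.symm (grad f p) = p := by
    rw [← he]
    exact e.left_inv hsrc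
  have hZ : ∀ᶠ w in 𝓝 ((Real.cos θ, Real.sin θ) : ℝ × ℝ),
      ContDiffAt ℝ 2 e.symm w ∧ e.symm w ∈ Ω ∧ grad f (e.symm w) = w := by
    rw [← hθ]
    filter_upwards [hsymm.eventually (by simp), e.open_target.mem_nhds htgt,
      hsymm.continuousAt (hsol.isOpen.mem_nhds (by rw [hback]; exact hp))] with w h1 h2 h3
    exact ⟨h1, h3, by rw [← he, e.right_inv h2]⟩
  obtain ⟨I, hθI, hγ⟩ := exists_isNondegenerateNullCurve hsol hZ
  have hγθ : boundaryCurve f e.symm θ = ![f p, p.1, p.2] := by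
    rw [boundaryCurve, ← hθ, hback]
  refine ⟨I, boundaryCurve f e.symm, θ, hγ, hθI, hγθ, exists_holomorphicExtension hγ.analytic,
    fun U Γ hΓ => ?_⟩
  obtain ⟨e', he', hsrc', -⟩ := exists_openPartialHomeomorph_proj hγ hΓ hθI
  have hgood := (goodSet_mem_nhds hγ hΓ hθI)
  have hgraph := eventually_phiHat_mem_graph hsol hZ hγ.isOpen hθI hΓ
  -- `V` lies in the chart where the projection is a homeomorphism onto its image, so that image is
  -- open and can serve as `Ω'`.
  obtain ⟨V, hV, hVo, hθV⟩ := mem_nhds_iff.1 (Filter.inter_mem (Filter.inter_mem hgood hgraph)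
    (e'.open_source.mem_nhds hsrc'))
  have hon : ∀ q ∈ V, proj (phiHat Γ) q ∈ Ω ∧
      phiHat Γ q = ![f (proj (phiHat Γ) q), (proj (phiHat Γ) q).1, (proj (phiHat Γ) q).2] := by
    intro q hq
    obtain ⟨z, hz, hφ⟩ := (hV hq).1.2
    have : proj (phiHat Γ) q = z := by simp [proj, hφ]
    rw [this]
    exact ⟨hz, hφ⟩
  have hprojθ : proj (phiHat Γ) (θ, 0) = p := by
    simp [proj, phiHat_zero hΓ hθI, hγθ]
  refine ⟨V, proj (phiHat Γ) '' V, hVo, hθV, fun q hq => (hV hq).1.1.1, ?_,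
    ⟨_, hθV, hprojθ⟩, ?_, fun q hq => (hV hq).1.1.2.1, ?_⟩
  · have : proj (phiHat Γ) = e' := funext fun q => (he' q).symm
    rw [this]
    exact e'.isOpen_image_of_subset_source hVo fun q hq => (hV hq).2
  · rintro _ ⟨q, hq, rfl⟩
    exact (hon q hq).1
  · rw [graphOver, Set.image_image]
    exact Set.image_congr fun q hq => (hon q hq).2

end Converse

end TypeChange

theorem mainTheorem1 :
    -- the direct part
    (∀ (I : Set ℝ) (γ : ℝ → TypeChange.Mink), TypeChange.IsNondegenerateNullCurve I γ →
      (∃ (U : Set ℂ) (Γ : ℂ → Fin 3 → ℂ), TypeChange.IsHolomorphicExtension I γ U Γ) ∧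
      ∀ (U : Set ℂ) (Γ : ℂ → Fin 3 → ℂ), TypeChange.IsHolomorphicExtension I γ U Γ →
        ∃ W : Set (ℝ × ℝ), IsOpen W ∧ (∀ u ∈ I, (u, (0 : ℝ)) ∈ W) ∧
          W ⊆ TypeChange.phiHatDomain I U ∧
          (∀ q ∈ W, ∀ j, TypeChange.phiHatC Γ q j = (TypeChange.phiHat Γ q j : ℂ)) ∧
          TypeChange.IsAnalyticZMCImmersion W (TypeChange.phiHat Γ) ∧
          ∀ u ∈ I, TypeChange.phiHat Γ (u, 0) = γ u ∧
            TypeChange.IsNondegenerateTypeChangeOfSurface W (TypeChange.phiHat Γ) (u, 0)) ∧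
    -- the converse
    (∀ (Ω : Set (ℝ × ℝ)) (f : ℝ × ℝ → ℝ) (p : ℝ × ℝ), TypeChange.IsZMCSolution Ω f → p ∈ Ω →
      TypeChange.IsNondegenerateTypeChange f p →
      ∃ (I : Set ℝ) (γ : ℝ → TypeChange.Mink) (u₀ : ℝ),
        TypeChange.IsNondegenerateNullCurve I γ ∧ u₀ ∈ I ∧ γ u₀ = ![f p, p.1, p.2] ∧
        (∃ (U : Set ℂ) (Γ : ℂ → Fin 3 → ℂ), TypeChange.IsHolomorphicExtension I γ U Γ) ∧
        ∀ (U : Set ℂ) (Γ : ℂ → Fin 3 → ℂ), TypeChange.IsHolomorphicExtension I γ U Γ →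
          ∃ (V Ω' : Set (ℝ × ℝ)), IsOpen V ∧ (u₀, (0 : ℝ)) ∈ V ∧
            V ⊆ TypeChange.phiHatDomain I U ∧ IsOpen Ω' ∧ p ∈ Ω' ∧ Ω' ⊆ Ω ∧
            (∀ q ∈ V, ∀ j, TypeChange.phiHatC Γ q j = (TypeChange.phiHat Γ q j : ℂ)) ∧
            TypeChange.phiHat Γ '' V = TypeChange.graphOver f Ω') := by
  exact ⟨fun I γ hγ => ⟨TypeChange.exists_holomorphicExtension hγ.analytic,
      fun U Γ hΓ => TypeChange.exists_analyticZMCImmersion hγ hΓ⟩,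
    fun Ω f p hsol hp ht => TypeChange.exists_nullCurve_of_typeChange hsol hp ht⟩
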